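/- Consider a primary transmitter of power $P_p>0$ with required rate $R>0$ and packet arrival rate $\lambda\in[0,1]$, and $N$ secondary transmitters with maximum power $P_{s,\max}\in(0,\infty)$. Let $\alpha_{s,i}$ and $\beta_{s,i}$ be the channel gains from the $i$th secondary transmitter to the primary and to the secondary receiver, and $\alpha_p,\beta_p$ those from the primary transmitter to the primary and to the secondary receiver; all gains are i.i.d. exponential random variables with mean one. Let $p_d\in[0,1)$ and $p_f\in[0,1]$ be the detection and false alarm probabilities of the sensing. The departure rate of the primary transmitter when a secondary transmitter with gain $a$ to the primary receiver uses power $s$ is $$\mu(a,s)=p_d\Pr\big[\log_2(1+\alpha_pP_p)\ge R\big]+(1-p_d)\Pr\Big[\log_2\Big(1+\tfrac{\alpha_pP_p}{1+as}\Big)\ge R\Big].$$ Put $R_p=(2^R-1)/P_p$, let $\mu_{\min}>p_de^{-R_p}$ be the minimum tolerable departure rate, and assume $$K=\frac1{R_p}\ln\Big(\frac{1-p_d}{\mu_{\min}-p_de^{-R_p}}\Big)-1>0 .$$ Put $P_{\mu,i}=K/\alpha_{s,i}$. In the upper-bound scenario the scheduled secondary transmitter has effective gains $\max_i\beta_{s,i}$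 and $\min_j\alpha_{s,j}$ and uses the power $P_s=\min\{K/\min_j\alpha_{s,j},P_{s,\max}\}$, so that its signal-to-noise ratio is $$\gamma_{s,up}=\begin{cases}K\max_i\beta_{s,i}/\min_j\alpha_{s,j},&\max_iP_{\mu,i}\le P_{s,\max},\\ P_{s,\max}\max_i\beta_{s,i},&\max_iP_{\mu,i}>P_{s,\max}.\end{cases}$$ For the regimes $A_1=\{\max_iP_{\mu,i}\le P_{s,\max}\}$ (unbounded power) and $A_2=A_1^c$ (saturated power) let $m_k=\mathbb E[\mu(\min_j\alpha_{s,j},P_s)\mid A_k]$, where $\mu(\cdot,\cdot)$ is evaluated at the random pair, and $$\mathbb E[C^{(k)}_{s,up}]=\frac{\lambda}{m_k}(1-p_d)\,\mathbb E\Big[\log_2\Big(1+\frac{\gamma_{s,up}}{1+\beta_pP_p}\Big)\Big|A_k\Big]+\Big(1-\frac{\lambda}{m_k}\Big)(1-p_f)\,\mathbb E\big[\log_2(1+\gamma_{s,up})\,\big|A_k\big],$$ and let $\mathbb E[C_{s,up}]=\Pr[A_1]\,\mathbb E[C^{(1)}_{s,up}]+\Pr[A_2]\,\mathbb E[C^{(2)}_{s,up}]$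 be the average capacity of the upper-bound scenario. Write $\mathrm E_1(x)=\int_x^\infty e^{-t}t^{-1}\,dt$, $L=\mathrm E_1(1/P_p)\,e^{1/P_p}/\ln2$, $w_N=e^{K/(P_{s,\max}\ln(1-1/N))}$, and $$\mathrm M_{avg,u}(N)=p_de^{-R_p}+(1-p_d)\frac{Ne^{-R_p(1+K)}\big(e^{K(R_pP_{s,\max}+N)/P_{s,\max}}-1\big)}{(R_pP_{s,\max}+N)\big(e^{KN/P_{s,\max}}-1\big)} ,$$ $$T_1(N)=\frac{\lambda}{\mu_{\min}}(1-p_d)\big(\log_2(P_{s,\max}\ln N)-L\big)+\Big(1-\frac{\lambda}{\mu_{\min}}\Big)(1-p_f)\log_2(P_{s,\max}\ln N),$$ $$T_2(N)=\frac{\lambda}{\mathrm M_{avg,u}(N)}(1-p_d)\big(\log_2(1+P_{s,\max}\ln N)-L\big)+\Big(1-\frac{\lambda}{\mathrm M_{avg,u}(N)}\Big)(1-p_f)\log_2(1+P_{s,\max}\ln N).$$ Then all the expectations above exist, and as $N\to\infty$ $$\mathbb E[C_{s,up}]-\big(w_N\,T_1(N)+(1-w_N)\,T_2(N)\big)\to0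 ;$$ moreover the two regimes match separately: $\mathbb E[C^{(1)}_{s,up}]-T_1(N)\to0$ and $\mathbb E[C^{(2)}_{s,up}]-T_2(N)\to0$. -/

import Mathlib

noncomputable section

namespace CognitiveRadio

open MeasureTheory ProbabilityTheory

/-- The exponential integral `E₁(x) = ∫_x^∞ e^{-t}/t dt` (used for `x > 0`). -/
def expInt1 (x : ℝ) : ℝ := ∫ t in Set.Ioi x, Real.exp (-t) / t

/-- System parameters. -/
structure Params where
  /-- average packet arrival rate `λ` of the primary transmitter -/
  lam : ℝ
  /-- minimum tolerable departure rate of the primary transmitter -/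
  muMin : ℝ
  /-- detection probability of the cooperative sensing -/
  pd : ℝ
  /-- false alarm probability of the cooperative sensing -/
  pf : ℝ
  /-- transmit power of the primary transmitter -/
  Pp : ℝ
  /-- required rate at the primary receiver -/
  R : ℝ
  /-- maximum transmit power of a secondary transmitter -/
  Pmax : ℝ

namespace Params

/-- `R_p = (2^R - 1) / P_p`. -/
def Rp (p : Params) : ℝ := ((2 : ℝ) ^ p.R - 1) / p.Pp

/-- `K = (1 / R_p) ln ((1 - p_d) / (μ_min - p_d e^{-R_p})) - 1`. -/
def K (p : Params) : ℝ :=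
  1 / p.Rp * Real.log ((1 - p.pd) / (p.muMin - p.pd * Real.exp (-p.Rp))) - 1

/-- Standing assumptions on the parameters. The field `muMin_gt` says that the logarithm in `K`
has a positive argument. -/
structure Valid (p : Params) : Prop where
  lam_nonneg : 0 ≤ p.lam
  lam_le_one : p.lam ≤ 1
  pd_nonneg : 0 ≤ p.pd
  pd_lt_one : p.pd < 1
  pf_nonneg : 0 ≤ p.pf
  pf_le_one : p.pf ≤ 1
  Pp_pos : 0 < p.Pp
  R_pos : 0 < p.R
  Pmax_pos : 0 < p.Pmax
  muMin_gt : p.pd * Real.exp (-p.Rp) < p.muMin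
  K_pos : 0 < p.K

/-- The power `P_μ = K / α` at which a secondary transmitter with gain `α` to the primary receiver
makes the departure rate of the primary transmitter equal to `μ_min`. -/
def powMu (p : Params) (a : ℝ) : ℝ := p.K / a

/-- The transmit power of a secondary transmitter with gain `α` to the primary receiver. -/
def txPower (p : Params) (a : ℝ) : ℝ :=
  if p.powMu a < 0 then 0 else if p.powMu a < p.Pmax then p.powMu a else p.Pmax

end Params

/-- The links of the system; the secondary transmitters are numbered by `ℕ`, and the system with
`N` secondary transmitters uses those with numbers below `N`. -/
inductive Link where
  /-- `i`-th secondary transmitter to primary receiver (gain `α_{s,i}`) -/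
  | secToPrim (i : ℕ)
  /-- `i`-th secondary transmitter to secondary receiver (gain `β_{s,i}`) -/
  | secToSec (i : ℕ)
  /-- primary transmitter to primary receiver (gain `α_p`) -/
  | primToPrim
  /-- primary transmitter to secondary receiver (gain `β_p`) -/
  | primToSec

variable {Ω : Type*} [MeasurableSpace Ω]

/-- Rayleigh fading: all channel gains are i.i.d. exponential random variables of mean one. -/
structure IsRayleigh (P : Measure Ω) (g : Link → Ω → ℝ) : Prop where
  measurable : ∀ l, Measurable (g l)
  law : ∀ l, HasLaw (g l) (expMeasure 1) P
  indep : iIndepFun g P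

/-- Outage probability of the primary link without interference. -/
def outage (p : Params) (P : Measure Ω) (g : Link → Ω → ℝ) : ℝ :=
  P.real {ω | Real.logb 2 (1 + g .primToPrim ω * p.Pp) < p.R}

/-- Outage probability of the primary link under interference from a secondary transmitter of
power `s` whose gain to the primary receiver is `a`. -/
def outageInf (p : Params) (P : Measure Ω) (g : Link → Ω → ℝ) (a s : ℝ) : ℝ :=
  P.real {ω | Real.logb 2 (1 + g .primToPrim ω * p.Pp / (1 + a * s)) < p.R}

/-- Departure rate `μ(a, s)` of the primary transmitter when a secondary transmitter with gain `a`
to the primary receiver is scheduled with power `s`. -/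
def departureRate (p : Params) (P : Measure Ω) (g : Link → Ω → ℝ) (a s : ℝ) : ℝ :=
  p.pd * (1 - outage p P g) + (1 - p.pd) * (1 - outageInf p P g a s)

/-- `max_i β_{s,i}` over `N` secondary transmitters. -/
def maxBeta (g : Link → Ω → ℝ) (N : ℕ) (ω : Ω) : ℝ := ⨆ i : Fin N, g (.secToSec i) ω

/-- `min_j α_{s,j}` over `N` secondary transmitters. -/
def minAlpha (g : Link → Ω → ℝ) (N : ℕ) (ω : Ω) : ℝ := ⨅ j : Fin N, g (.secToPrim j) ω

/-- The unbounded-power event `max_i P_{μ,i} ≤ P_{s,max}`. -/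
def unboundedRegime (p : Params) (g : Link → Ω → ℝ) (N : ℕ) : Set Ω :=
  {ω | ⨆ i : Fin N, p.powMu (g (.secToPrim i) ω) ≤ p.Pmax}

open scoped Classical in
/-- The effective signal-to-noise ratio `γ_{s,up}`. -/
def snrUp (p : Params) (g : Link → Ω → ℝ) (N : ℕ) (ω : Ω) : ℝ :=
  if ω ∈ unboundedRegime p g N then p.K * maxBeta g N ω / minAlpha g N ω
  else p.Pmax * maxBeta g N ω

/-- Rate of the scheduled secondary transmitter when the primary transmitter is idle. -/
def rateIdle (p : Params) (g : Link → Ω → ℝ) (N : ℕ) (ω : Ω) : ℝ :=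
  Real.logb 2 (1 + snrUp p g N ω)

/-- Rate of the scheduled secondary transmitter under interference from the primary
transmitter. -/
def rateBusy (p : Params) (g : Link → Ω → ℝ) (N : ℕ) (ω : Ω) : ℝ :=
  Real.logb 2 (1 + snrUp p g N ω / (1 + g .primToSec ω * p.Pp))

/-- Average departure rate of the primary transmitter given the event `A`, when the scheduled
secondary transmitter has the effective interference gain `min_j α_{s,j}`. -/
def meanDeparture (p : Params) (P : Measure Ω) (g : Link → Ω → ℝ) (N : ℕ) (A : Set Ω) : ℝ :=
  ∫ ω, departureRate p P g (minAlpha g N ω) (p.txPower (minAlpha g N ω)) ∂(cond P A)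

/-- The average capacity in a slot in which the primary transmitter is active a fraction
`lam / m` of the time (`m` its departure rate): an active primary transmitter is missed with
probability `1 - p_d` and an idle one is recognized with probability `1 - p_f`; `cBusy` and `cIdle`
are the average rates of the secondary network in the two cases. -/
def trafficAverage (p : Params) (m cBusy cIdle : ℝ) : ℝ :=
  p.lam / m * (1 - p.pd) * cBusy + (1 - p.lam / m) * (1 - p.pf) * cIdle

/-- Average capacity of the upper-bound scenario given the event `A`. -/
def condCapacityUp (p : Params) (P : Measure Ω) (g : Link → Ω → ℝ) (N : ℕ) (A : Set Ω) : ℝ :=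
  trafficAverage p (meanDeparture p P g N A)
    (∫ ω, rateBusy p g N ω ∂(cond P A)) (∫ ω, rateIdle p g N ω ∂(cond P A))

/-- The average capacity `E[C_{s,up}]` of the upper-bound scenario with `N` secondary
transmitters. -/
def capacityUp (p : Params) (P : Measure Ω) (g : Link → Ω → ℝ) (N : ℕ) : ℝ :=
  P.real (unboundedRegime p g N) * condCapacityUp p P g N (unboundedRegime p g N) +
    P.real (unboundedRegime p g N)ᶜ * condCapacityUp p P g N (unboundedRegime p g N)ᶜ

/-- `M_{avg,u}(N)`. -/
def MavgU (p : Params) (N : ℕ) : ℝ :=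
  p.pd * Real.exp (-p.Rp) +
    (1 - p.pd) *
      (N * Real.exp (-p.Rp * (1 + p.K)) *
          (Real.exp (p.K * (p.Rp * p.Pmax + N) / p.Pmax) - 1) /
        ((p.Rp * p.Pmax + N) * (Real.exp (p.K * N / p.Pmax) - 1)))

/-- The interference loss `E₁(1/P_p) e^{1/P_p} / ln 2`. -/
def interferenceLoss (p : Params) : ℝ :=
  expInt1 (1 / p.Pp) * Real.exp (1 / p.Pp) / Real.log 2

/-- The weight `exp (K / (P_{s,max} ln (1 - 1/N)))` of the unbounded-power regime. -/
def weight (p : Params) (N : ℕ) : ℝ :=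
  Real.exp (p.K / (p.Pmax * Real.log (1 - 1 / (N : ℝ))))

/-- The asymptotic expression for the unbounded-power regime. -/
def asympUnbounded (p : Params) (N : ℕ) : ℝ :=
  p.lam / p.muMin * (1 - p.pd) *
      (Real.logb 2 (p.Pmax * Real.log N) - interferenceLoss p) +
    (1 - p.lam / p.muMin) * (1 - p.pf) * Real.logb 2 (p.Pmax * Real.log N)

/-- The asymptotic expression for the saturated regime. -/
def asympSaturated (p : Params) (N : ℕ) : ℝ :=
  p.lam / MavgU p N * (1 - p.pd) *
      (Real.logb 2 (1 + p.Pmax * Real.log N) - interferenceLoss p) +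
    (1 - p.lam / MavgU p N) * (1 - p.pf) * Real.logb 2 (1 + p.Pmax * Real.log N)

end CognitiveRadio

end

noncomputable section

namespace CognitiveRadio

open MeasureTheory ProbabilityTheory Filter Topology

/-! ### The exponential distribution -/

/-! Write `A` for the minimum of the gains to the primary receiver, `X` for the maximum of the gains
to the secondary receiver, `β` for the gain from the primary transmitter to the secondary receiver,
and `c = K / P_max`. Almost surely the unbounded regime is the event `c ≤ A`, and `A` is exponential
of rate `N`.

In both regimes the signal-to-noise ratio is `P_max X / (1 + e)` with `e = (A - c)⁺ / c`
(`ae_snrUp_eq`), and the factor `1 + e` changes the logarithm by at most `e`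
(`abs_log_one_add_div_sub_le`). Given the unbounded regime the excess `(A - c)⁺` has mean `1/N`,
because the exponential law has no memory; in the saturated regime it is zero. So each conditional
mean rate is within `O(1/N)` of the rate at maximum power. That rate depends on `X` and `β` only,
hence is independent of the regime, and the conditioning disappears.

Against interference of power `q` the mean rate at maximum power is, in nats, `E[ln(1 + βq + P_max
X)] - E[ln(1 + βq)]`. The second term is zero for `q = 0` and, divided by `ln 2`, is the
interference loss for `q = P_p`. The first is `ln(1 + P_max ln N) + o(1)`: from above by a tangent
line of the logarithm and `E[X] ≤ ln N + 1` (`integral_logPower_le`), from below because `X` drops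
under `ln N - ln ln N` with probability at most `1/N` (`le_integral_logPower`).

The mean departure rates are exact: `μ_min` in the unbounded regime, `M_avg,u(N) ≥ μ_min` in the
saturated one. The traffic coefficients therefore stay bounded, and errors `o(1)` in the rates give
errors `o(1)` in the capacities. In the mixture, `Pr[A₁] = e^{-cN}` and `w_N` are both `O(e^{-cN})`
while `T₁ - T₂ = O(N)`, so one weight may replace the other. -/

lemma expMeasure_eq_withDensity (r : ℝ) :
    expMeasure r = (volume.restrict (Set.Ioi 0)).withDensity
      (fun x => ENNReal.ofReal (r * Real.exp (-(r * x)))) := by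
  rw [restrict_Ioi_eq_restrict_Ici, ← withDensity_indicator measurableSet_Ici]
  unfold expMeasure gammaMeasure
  congr 1
  ext x
  change exponentialPDF r x = _
  rw [exponentialPDF_eq, Set.indicator_apply]
  simp only [Set.mem_Ici]
  split_ifs <;> simp

lemma integral_expMeasure {r : ℝ} (hr : 0 < r) (f : ℝ → ℝ) :
    ∫ x, f x ∂(expMeasure r) = ∫ x in Set.Ioi 0, r * Real.exp (-(r * x)) * f x := by
  rw [expMeasure_eq_withDensity, integral_withDensity_eq_integral_toReal_smul (by fun_prop)
    (by simp)]
  refine integral_congr_ae (ae_of_all _ fun x => ?_)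
  dsimp only
  rw [ENNReal.toReal_ofReal (by positivity), smul_eq_mul]

lemma integrable_expMeasure_iff {r : ℝ} (hr : 0 < r) (f : ℝ → ℝ) :
    Integrable f (expMeasure r) ↔
      IntegrableOn (fun x => r * Real.exp (-(r * x)) * f x) (Set.Ioi 0) := by
  rw [expMeasure_eq_withDensity, integrable_withDensity_iff_integrable_smul' (by fun_prop)
    (by simp), IntegrableOn]
  refine integrable_congr (ae_of_all _ fun x => ?_)
  dsimp only
  rw [ENNReal.toReal_ofReal (by positivity), smul_eq_mul]

instance nullSingletonClass_expMeasure (r : ℝ) : NullSingletonClass (expMeasure r) := by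
  unfold expMeasure gammaMeasure
  infer_instance

lemma expMeasure_real_Ioi {r x : ℝ} (hr : 0 < r) (hx : 0 ≤ x) :
    (expMeasure r).real (Set.Ioi x) = Real.exp (-(r * x)) := by
  have := isProbabilityMeasure_expMeasure hr
  have h := cdf_expMeasure_eq hr x
  rw [cdf_eq_real, if_pos hx] at h
  rw [← Set.compl_Iic, probReal_compl_eq_one_sub measurableSet_Iic, h]
  ring

lemma expMeasure_real_Ici {r x : ℝ} (hr : 0 < r) (hx : 0 ≤ x) :
    (expMeasure r).real (Set.Ici x) = Real.exp (-(r * x)) := by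
  rw [← expMeasure_real_Ioi hr hx]
  exact measureReal_congr Ioi_ae_eq_Ici.symm

lemma expMeasure_real_Iio {r x : ℝ} (hr : 0 < r) (hx : 0 ≤ x) :
    (expMeasure r).real (Set.Iio x) = 1 - Real.exp (-(r * x)) := by
  have := isProbabilityMeasure_expMeasure hr
  rw [← Set.compl_Ici, probReal_compl_eq_one_sub measurableSet_Ici, expMeasure_real_Ici hr hx]

lemma ae_pos_expMeasure (r : ℝ) : ∀ᵐ x ∂(expMeasure r), 0 < x := by
  rw [expMeasure_eq_withDensity]
  exact (withDensity_absolutelyContinuous _ _).ae_le (ae_restrict_mem measurableSet_Ioi)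

/-- Mean excess of the exponential distribution over a level `t ≥ 0`. -/
lemma integral_posPart_sub_expMeasure {r t : ℝ} (hr : 0 < r) (ht : 0 ≤ t) :
    Integrable (fun x => max (x - t) 0) (expMeasure r) ∧
      ∫ x, max (x - t) 0 ∂(expMeasure r) = Real.exp (-(r * t)) / r := by
  have hderiv : ∀ x ∈ Set.Ici t, HasDerivAt (fun x => -(x - t + 1 / r) * Real.exp (-(r * x)))
      (r * Real.exp (-(r * x)) * (x - t)) x := by
    intro x _
    have h1 : HasDerivAt (fun x : ℝ => -(x - t + 1 / r)) (-1) x :=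
      (((hasDerivAt_id x).sub_const t).add_const (1 / r)).neg
    have h2 : HasDerivAt (fun x : ℝ => Real.exp (-(r * x))) (Real.exp (-(r * x)) * -r) x := by
      simpa using (((hasDerivAt_id x).const_mul r).neg).exp
    convert! h1.mul h2 using 1
    field_simp
    ring
  have hnn : ∀ x ∈ Set.Ioi t, 0 ≤ r * Real.exp (-(r * x)) * (x - t) := fun x hx =>
    mul_nonneg (by positivity) (sub_nonneg.2 (le_of_lt hx))
  have hexp : Tendsto (fun x : ℝ => Real.exp (-(r * x))) atTop (𝓝 0) :=
    Real.tendsto_exp_neg_atTop_nhds_zero.comp (tendsto_id.const_mul_atTop hr)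
  have hmul : Tendsto (fun x : ℝ => r * x * Real.exp (-(r * x))) atTop (𝓝 0) := by
    have := (Real.tendsto_pow_mul_exp_neg_atTop_nhds_zero 1).comp (tendsto_id.const_mul_atTop hr)
    simpa [Function.comp_def] using this
  have hlim : Tendsto (fun x => -(x - t + 1 / r) * Real.exp (-(r * x))) atTop (𝓝 0) := by
    have := (hmul.const_mul (-(1 / r))).add (hexp.const_mul (t - 1 / r))
    simp only [mul_zero, add_zero] at this
    refine this.congr fun x => ?_
    field_simp
    ring
  have hint := integrableOn_Ioi_deriv_of_nonneg' hderiv hnn hlim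
  have hval := integral_Ioi_of_hasDerivAt_of_nonneg' hderiv hnn hlim
  have hind : ∀ x, (Set.Ioi t).indicator (fun x => r * Real.exp (-(r * x)) * (x - t)) x =
      r * Real.exp (-(r * x)) * max (x - t) 0 := by
    intro x
    by_cases hx : x ∈ Set.Ioi t
    · rw [Set.indicator_of_mem hx, max_eq_left (sub_nonneg.2 (le_of_lt hx))]
    · rw [Set.indicator_of_notMem hx, max_eq_right (sub_nonpos.2 (not_lt.1 hx)), mul_zero]
  constructor
  · rw [integrable_expMeasure_iff hr]
    simp_rw [← hind]
    exact (hint.integrable_indicator measurableSet_Ioi).integrableOn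
  · rw [integral_expMeasure hr]
    simp_rw [← hind]
    rw [setIntegral_indicator measurableSet_Ioi,
      Set.inter_eq_right.2 (Set.Ioi_subset_Ioi ht), hval]
    simp
    ring

lemma integral_id_expMeasure {r : ℝ} (hr : 0 < r) :
    Integrable (fun x => x) (expMeasure r) ∧ ∫ x, x ∂(expMeasure r) = 1 / r := by
  obtain ⟨h1, h2⟩ := integral_posPart_sub_expMeasure hr le_rfl
  have h : (fun x : ℝ => max (x - 0) 0) =ᵐ[expMeasure r] fun x => x := by
    filter_upwards [ae_pos_expMeasure r] with x hx
    rw [sub_zero, max_eq_left hx.le]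
  refine ⟨h1.congr h, ?_⟩
  rw [← integral_congr_ae h, h2]
  simp

/-- Laplace transform of the exponential distribution restricted to an initial interval. -/
lemma setIntegral_exp_neg_expMeasure {r s t : ℝ} (hr : 0 < r) (hs : 0 ≤ s) (ht : 0 ≤ t) :
    ∫ x in Set.Iio t, Real.exp (-(s * x)) ∂(expMeasure r) =
      r * (1 - Real.exp (-((r + s) * t))) / (r + s) := by
  rw [← integral_indicator measurableSet_Iio, integral_expMeasure hr]
  have h : ∀ x, r * Real.exp (-(r * x)) *
      (Set.Iio t).indicator (fun x => Real.exp (-(s * x))) x =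
      (Set.Iio t).indicator (fun x => r * Real.exp (-(r + s) * x)) x := by
    intro x
    by_cases hx : x ∈ Set.Iio t
    · rw [Set.indicator_of_mem hx, Set.indicator_of_mem hx, mul_assoc, ← Real.exp_add]
      ring_nf
    · rw [Set.indicator_of_notMem hx, Set.indicator_of_notMem hx, mul_zero]
  simp_rw [h]
  have hrs : 0 < r + s := by positivity
  rw [setIntegral_indicator measurableSet_Iio, Set.Ioi_inter_Iio, ← integral_Ioc_eq_integral_Ioo,
    ← intervalIntegral.integral_of_le ht, intervalIntegral.integral_const_mul,
    intervalIntegral.integral_comp_mul_left (fun x => Real.exp x) (by linarith : -(r + s) ≠ 0),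
    integral_exp]
  simp only [mul_zero, Real.exp_zero, smul_eq_mul]
  rw [inv_neg, neg_mul (r + s) t]
  field_simp
  ring

/-- `E[ln (1 + q β)] = E₁(1/q) e^{1/q}` for an exponential random variable `β` of mean one. -/
lemma integral_log_one_add_mul_expMeasure {q : ℝ} (hq : 0 < q) :
    ∫ x, Real.log (1 + q * x) ∂(expMeasure 1) = expInt1 (1 / q) * Real.exp (1 / q) := by
  rw [integral_expMeasure one_pos]
  simp only [one_mul]
  have hlog : ∀ x : ℝ, 0 ≤ x → 0 ≤ Real.log (1 + q * x) ∧ Real.log (1 + q * x) ≤ q * x := by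
    intro x hx
    have hqx : 0 ≤ q * x := by positivity
    exact ⟨Real.log_nonneg (by linarith), by
      linarith [Real.log_le_sub_one_of_pos (by linarith : 0 < 1 + q * x)]⟩
  have hexpint : IntegrableOn (fun x : ℝ => Real.exp (-x)) (Set.Ioi 0) := by
    simpa using exp_neg_integrableOn_Ioi 0 one_pos
  have hint1 : IntegrableOn (fun x : ℝ => Real.exp (-x) * Real.log (1 + q * x)) (Set.Ioi 0) := by
    have h := ((integrable_expMeasure_iff one_pos _).1
      (integral_id_expMeasure one_pos).1).const_mul q
    refine Integrable.mono' h (by fun_prop) ?_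
    filter_upwards [ae_restrict_mem measurableSet_Ioi] with x hx
    obtain ⟨h1, h2⟩ := hlog x (le_of_lt hx)
    rw [Real.norm_of_nonneg (by positivity)]
    simp only [one_mul]
    nlinarith [Real.exp_pos (-x)]
  have hint2 : IntegrableOn (fun x : ℝ => Real.exp (-x) * (q / (1 + q * x))) (Set.Ioi 0) := by
    refine Integrable.mono' (hexpint.const_mul q) (by fun_prop) ?_
    filter_upwards [ae_restrict_mem measurableSet_Ioi] with x hx
    have hqx : 0 < q * x := mul_pos hq hx
    rw [Real.norm_of_nonneg (by positivity), mul_comm q (Real.exp _)]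
    exact mul_le_mul_of_nonneg_left (div_le_self hq.le (by linarith)) (Real.exp_pos _).le
  have hderiv : ∀ x ∈ Set.Ici (0 : ℝ), HasDerivAt (fun x => -(Real.exp (-x) * Real.log (1 + q * x)))
      (Real.exp (-x) * Real.log (1 + q * x) - Real.exp (-x) * (q / (1 + q * x))) x := by
    intro x hx
    have hx0 : 0 ≤ x := hx
    have hqx : 0 ≤ q * x := by positivity
    have h1 : HasDerivAt (fun x : ℝ => Real.exp (-x)) (Real.exp (-x) * -1) x :=
      (hasDerivAt_id x).neg.exp
    have h2 : HasDerivAt (fun x : ℝ => 1 + q * x) q x := by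
      simpa using ((hasDerivAt_id x).const_mul q).const_add 1
    convert! (h1.mul (h2.log (by linarith))).neg using 1
    ring
  have hlim : Tendsto (fun x => -(Real.exp (-x) * Real.log (1 + q * x))) atTop (𝓝 0) := by
    rw [← neg_zero]
    refine Tendsto.neg (squeeze_zero' ?_ ?_
      (by simpa using (Real.tendsto_pow_mul_exp_neg_atTop_nhds_zero 1).const_mul q))
    · filter_upwards [eventually_ge_atTop 0] with x hx
      have := (hlog x hx).1
      positivity
    · filter_upwards [eventually_ge_atTop 0] with x hx
      have := (hlog x hx).2
      nlinarith [Real.exp_pos (-x)]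
  have hval := integral_Ioi_of_hasDerivAt_of_tendsto' hderiv (hint1.sub hint2) hlim
  rw [integral_sub hint1 hint2] at hval
  simp only [mul_zero, add_zero, Real.log_one, neg_zero, sub_zero] at hval
  rw [sub_eq_zero.1 hval, expInt1, ← integral_mul_const]
  -- The shift `t = x + 1/q` turns `e^{-x} q / (1 + qx)` into `e^{1/q} e^{-t} / t`.
  have hsub := (measurePreserving_add_right volume (1 / q)).setIntegral_preimage_emb
    (measurableEmbedding_addRight (1 / q)) (fun t : ℝ => Real.exp (-t) / t * Real.exp (1 / q))
    (Set.Ioi (1 / q))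
  rw [← hsub]
  have hpre : (fun x => x + 1 / q) ⁻¹' Set.Ioi (1 / q) = Set.Ioi 0 := by
    ext x
    simp
  rw [hpre]
  refine setIntegral_congr_fun measurableSet_Ioi fun x hx => ?_
  have hqx : 0 < q * x := mul_pos hq hx
  rw [neg_add, Real.exp_add, Real.exp_neg (1 / q)]
  have : 0 < Real.exp (1 / q) := Real.exp_pos _
  field_simp
  ring

/-! ### The channel gains -/

variable {Ω : Type*} [MeasurableSpace Ω] {P : Measure Ω} {g : Link → Ω → ℝ}

namespace IsRayleigh

lemma ae_gain_pos (hg : IsRayleigh P g) (l : Link) : ∀ᵐ ω ∂P, 0 < g l ω :=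
  ((hg.law l).ae_iff (p := fun x => 0 < x) (measurableSet_setOfPred.1 measurableSet_Ioi)).2
    (ae_pos_expMeasure 1)

lemma ae_pos (hg : IsRayleigh P g) : ∀ᵐ ω ∂P, (∀ i, 0 < g (.secToPrim i) ω) ∧
    (∀ i, 0 < g (.secToSec i) ω) ∧ 0 < g .primToSec ω := by
  filter_upwards [ae_all_iff.2 fun i => hg.ae_gain_pos (.secToPrim i),
    ae_all_iff.2 fun i => hg.ae_gain_pos (.secToSec i), hg.ae_gain_pos .primToSec]
    with ω h1 h2 h3 using ⟨h1, h2, h3⟩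

lemma real_lt_gain (hg : IsRayleigh P g) (l : Link) {x : ℝ} (hx : 0 ≤ x) :
    P.real {ω | x < g l ω} = Real.exp (-x) := by
  rw [(hg.law l).measureReal_eq (p := fun y => x < y) measurableSet_Ioi]
  have := expMeasure_real_Ioi one_pos hx
  rwa [one_mul] at this

lemma real_gain_lt (hg : IsRayleigh P g) (l : Link) {x : ℝ} (hx : 0 ≤ x) :
    P.real {ω | g l ω < x} = 1 - Real.exp (-x) := by
  rw [(hg.law l).measureReal_eq (p := fun y => y < x) measurableSet_Iio]
  have := expMeasure_real_Iio one_pos hx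
  rwa [one_mul] at this

lemma measurable_maxBeta (hg : IsRayleigh P g) (N : ℕ) : Measurable (maxBeta g N) :=
  Measurable.iSup fun _ => hg.measurable _

lemma measurable_minAlpha (hg : IsRayleigh P g) (N : ℕ) : Measurable (minAlpha g N) :=
  Measurable.iInf fun _ => hg.measurable _

lemma measurableSet_unboundedRegime (hg : IsRayleigh P g) (p : Params) (N : ℕ) :
    MeasurableSet (unboundedRegime p g N) :=
  measurableSet_le (Measurable.iSup fun _ => (hg.measurable _).const_div _) measurable_const

lemma maxBeta_nonneg_ae (hg : IsRayleigh P g) (N : ℕ) : ∀ᵐ ω ∂P, 0 ≤ maxBeta g N ω := by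
  filter_upwards [hg.ae_pos] with ω h
  exact Real.iSup_nonneg fun i => (h.2.1 i).le

/-- The joint probability of events on the gains of `N` distinct links, all of the same
probability. -/
lemma real_forall_gain_mem (hg : IsRayleigh P g) {l : ℕ → Link} (hl : Function.Injective l) (N : ℕ)
    {B : Set ℝ} (hB : MeasurableSet B) {q : ℝ} (hq : ∀ i, P.real {ω | g (l i) ω ∈ B} = q) :
    P.real {ω | ∀ i : Fin N, g (l i) ω ∈ B} = q ^ N := by
  have hind : iIndepFun (fun i : Fin N => g (l i)) P :=
    hg.indep.precomp (g := fun i : Fin N => l i) (hl.comp Fin.val_injective)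
  have h := hind.measure_inter_preimage_eq_mul Finset.univ (sets := fun _ => B) fun _ _ => hB
  have hset : {ω | ∀ i : Fin N, g (l i) ω ∈ B} =
      ⋂ i ∈ (Finset.univ : Finset (Fin N)), g (l i) ⁻¹' B := by
    ext ω
    simp
  rw [hset, measureReal_def, h, ENNReal.toReal_prod]
  simp_rw [← measureReal_def]
  calc ∏ i : Fin N, P.real (g (l i) ⁻¹' B) = ∏ _i : Fin N, q :=
        Finset.prod_congr rfl fun i _ => hq i
    _ = q ^ N := by simp

/-- The minimum of `N` independent exponential gains is exponential of rate `N`. -/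
lemma hasLaw_minAlpha [IsProbabilityMeasure P] (hg : IsRayleigh P g) {N : ℕ} (hN : 0 < N) :
    HasLaw (minAlpha g N) (expMeasure N) P := by
  have hNr : (0 : ℝ) < N := Nat.cast_pos.2 hN
  have := isProbabilityMeasure_expMeasure hNr
  have hmeas := hg.measurable_minAlpha N
  have : IsProbabilityMeasure (P.map (minAlpha g N)) :=
    Measure.isProbabilityMeasure_map hmeas.aemeasurable
  have : Nonempty (Fin N) := ⟨⟨0, hN⟩⟩
  refine ⟨hmeas.aemeasurable, Measure.eq_of_cdf _ _ ?_⟩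
  ext x
  rw [cdf_eq_real, cdf_expMeasure_eq hNr, map_measureReal_apply hmeas measurableSet_Iic]
  have hcompl : minAlpha g N ⁻¹' Set.Iic x = {ω | ∀ i : Fin N, g (.secToPrim i) ω ∈ Set.Ioi x}ᶜ := by
    ext ω
    obtain ⟨j, hj⟩ := exists_eq_ciInf_of_finite (f := fun i : Fin N => g (.secToPrim i) ω)
    simp only [Set.mem_preimage, Set.mem_Iic, Set.mem_compl_iff, Set.mem_ofPred_eq, Set.mem_Ioi,
      not_forall, not_lt]
    constructor
    · intro h
      exact ⟨j, hj.trans_le h⟩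
    · rintro ⟨i, hi⟩
      exact (ciInf_le (Set.finite_range _).bddBelow i).trans hi
  have hset : MeasurableSet {ω | ∀ i : Fin N, g (.secToPrim i) ω ∈ Set.Ioi x} := by
    simp only [Set.ofPred_forall]
    exact MeasurableSet.iInter fun i => hg.measurable _ measurableSet_Ioi
  have hinj : Function.Injective Link.secToPrim := fun _ _ h => Link.secToPrim.inj h
  rw [hcompl, probReal_compl_eq_one_sub hset]
  split_ifs with hx
  · rw [hg.real_forall_gain_mem hinj N measurableSet_Ioi
      (fun i => hg.real_lt_gain (.secToPrim i) hx), ← Real.exp_nat_mul]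
    ring_nf
  · have h1 : ∀ᵐ ω ∂P, ω ∈ {ω | ∀ i : Fin N, g (.secToPrim i) ω ∈ Set.Ioi x} := by
      filter_upwards [hg.ae_pos] with ω h i
      exact (not_le.1 hx).trans (h.1 i)
    rw [measureReal_def, (mem_ae_iff_prob_eq_one hset).1 h1]
    simp

/-- Lower tail of the maximum of `N` independent exponential gains. -/
lemma real_maxBeta_lt_le (hg : IsRayleigh P g) {N : ℕ} {s : ℝ} (hs : 0 ≤ s) [IsProbabilityMeasure P] :
    P.real {ω | maxBeta g N ω < s} ≤ Real.exp (-(N * Real.exp (-s))) := by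
  have hinj : Function.Injective Link.secToSec := fun _ _ h => Link.secToSec.inj h
  calc P.real {ω | maxBeta g N ω < s}
      ≤ P.real {ω | ∀ i : Fin N, g (.secToSec i) ω ∈ Set.Iio s} :=
        measureReal_mono fun ω h i =>
          (le_ciSup (f := fun i : Fin N => g (.secToSec i) ω) (Set.finite_range _).bddAbove i).trans_lt h
    _ = (1 - Real.exp (-s)) ^ N := hg.real_forall_gain_mem hinj N measurableSet_Iio
        fun i => hg.real_gain_lt (.secToSec i) hs
    _ ≤ (Real.exp (-Real.exp (-s))) ^ N := by
        gcongr
        · simpa using hs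
        · linarith [Real.add_one_le_exp (-Real.exp (-s))]
    _ = Real.exp (-(N * Real.exp (-s))) := by
        rw [← Real.exp_nat_mul, mul_neg]

lemma integral_posPart_gain_sub (hg : IsRayleigh P g) (l : Link) {t : ℝ} (ht : 0 ≤ t) :
    Integrable (fun ω => max (g l ω - t) 0) P ∧
      ∫ ω, max (g l ω - t) 0 ∂P = Real.exp (-t) := by
  obtain ⟨h1, h2⟩ := integral_posPart_sub_expMeasure one_pos ht
  have hl := hg.law l
  rw [← hl.map_eq] at h1
  constructor
  · exact (integrable_map_measure h1.aestronglyMeasurable hl.aemeasurable).1 h1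
  · have h3 := hl.integral_comp (f := fun x => max (x - t) 0) (by fun_prop)
    simp only [Function.comp_def] at h3
    rw [h3, h2]
    simp

/-- The largest gain exceeds `t` by no more than the sum of all excesses, whose means are `e^{-t}`
each. For `N = 0` the supremum is `0` by convention, which is where `0 ≤ t` enters. -/
lemma maxBeta_le_add_sum {Ω : Type*} (g : Link → Ω → ℝ) (N : ℕ) {t : ℝ} (ht : 0 ≤ t) (ω : Ω) :
    maxBeta g N ω ≤ t + ∑ i : Fin N, max (g (.secToSec i) ω - t) 0 := by
  have hnn : ∀ i ∈ (Finset.univ : Finset (Fin N)), 0 ≤ max (g (.secToSec i) ω - t) 0 :=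
    fun i _ => le_max_right _ _
  refine Real.iSup_le (fun i => ?_) (add_nonneg ht (Finset.sum_nonneg hnn))
  have h1 := Finset.single_le_sum hnn (Finset.mem_univ i)
  have h2 := le_max_left (g (.secToSec i) ω - t) 0
  linarith

lemma integrable_maxBeta [IsProbabilityMeasure P] (hg : IsRayleigh P g) (N : ℕ) :
    Integrable (maxBeta g N) P := by
  refine Integrable.mono' (g := fun ω => 0 + ∑ i : Fin N, max (g (.secToSec i) ω - 0) 0)
    ((integrable_const _).add (integrable_finsetSum _ fun i _ =>
      (hg.integral_posPart_gain_sub (.secToSec i) le_rfl).1))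
    (hg.measurable_maxBeta N).aestronglyMeasurable ?_
  filter_upwards [hg.maxBeta_nonneg_ae N] with ω h
  rw [Real.norm_of_nonneg h]
  exact maxBeta_le_add_sum g N le_rfl ω

/-- At the level `t = ln N` the `N` mean excesses are `1/N` each and add up to `1`. -/
lemma integral_maxBeta_le [IsProbabilityMeasure P] (hg : IsRayleigh P g) {N : ℕ} (hN : 0 < N) :
    ∫ ω, maxBeta g N ω ∂P ≤ Real.log N + 1 := by
  have hlog : 0 ≤ Real.log N := Real.log_natCast_nonneg N
  have hint := fun i : Fin N => hg.integral_posPart_gain_sub (.secToSec i) hlog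
  have hsum : Integrable (fun ω => ∑ i : Fin N, max (g (.secToSec i) ω - Real.log N) 0) P :=
    integrable_finsetSum _ fun i _ => (hint i).1
  calc ∫ ω, maxBeta g N ω ∂P
      ≤ ∫ ω, (Real.log N + ∑ i : Fin N, max (g (.secToSec i) ω - Real.log N) 0) ∂P :=
        integral_mono (hg.integrable_maxBeta N) ((integrable_const _).add hsum)
          (maxBeta_le_add_sum g N hlog)
    _ = Real.log N + ∑ i : Fin N, Real.exp (-Real.log N) := by
        rw [integral_add (integrable_const _) hsum, integral_finsetSum _ fun i _ => (hint i).1]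
        simp only [integral_const, probReal_univ, one_smul]
        congr 1
        exact Finset.sum_congr rfl fun i _ => (hint i).2
    _ = Real.log N + 1 := by
        have : (N : ℝ) ≠ 0 := Nat.cast_ne_zero.2 hN.ne'
        rw [Real.exp_neg, Real.exp_log (Nat.cast_pos.2 hN)]
        simp [this]

lemma integral_primToSec (hg : IsRayleigh P g) :
    Integrable (g .primToSec) P ∧ ∫ ω, g .primToSec ω ∂P = 1 := by
  obtain ⟨h1, h2⟩ := integral_id_expMeasure one_pos
  have hl := hg.law .primToSec
  have h3 := hl.integral_eq
  rw [← hl.map_eq] at h1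
  exact ⟨(integrable_map_measure h1.aestronglyMeasurable hl.aemeasurable).1 h1, by
    rw [h3, h2]; simp⟩

lemma integral_log_one_add_primToSec (hg : IsRayleigh P g) {q : ℝ} (hq : 0 < q) :
    ∫ ω, Real.log (1 + g .primToSec ω * q) ∂P = expInt1 (1 / q) * Real.exp (1 / q) := by
  rw [← integral_log_one_add_mul_expMeasure hq]
  have h3 := (hg.law .primToSec).integral_comp (f := fun x => Real.log (1 + q * x))
    (by fun_prop : Measurable fun x : ℝ => Real.log (1 + q * x)).aestronglyMeasurable
  rw [← h3]
  simp only [Function.comp_def, mul_comm]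

/-- The gains to the primary receiver are independent of the effective gains to the secondary
receiver. -/
lemma indepFun_secToPrim (hg : IsRayleigh P g) (N : ℕ) :
    IndepFun (fun ω (i : Fin N) => g (.secToPrim i) ω)
      (fun ω => (maxBeta g N ω, g .primToSec ω)) P := by
  classical
  let S : Finset Link := (Finset.range N).image Link.secToPrim
  let T : Finset Link := insert Link.primToSec ((Finset.range N).image Link.secToSec)
  have hST : Disjoint S T := by
    rw [Finset.disjoint_left]
    intro l hS hT
    simp only [S, T, Finset.mem_image, Finset.mem_insert] at hS hT
    obtain ⟨i, -, rfl⟩ := hS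
    simp at hT
  have hS : ∀ i : Fin N, Link.secToPrim i ∈ S := fun i =>
    Finset.mem_image_of_mem _ (Finset.mem_range.2 i.2)
  have hT : ∀ i : Fin N, Link.secToSec i ∈ T := fun i =>
    Finset.mem_insert_of_mem (Finset.mem_image_of_mem _ (Finset.mem_range.2 i.2))
  have h := hg.indep.indepFun_finset S T hST hg.measurable
  have hψ : Measurable fun x : T → ℝ =>
      (⨆ i : Fin N, x ⟨_, hT i⟩, x ⟨_, Finset.mem_insert_self _ _⟩) :=
    (Measurable.iSup fun i => by fun_prop).prodMk (by fun_prop)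
  exact h.comp (φ := fun x (i : Fin N) => x ⟨_, hS i⟩)
    (measurable_pi_lambda _ fun i => measurable_pi_apply _) hψ

end IsRayleigh

lemma integral_cond_eq (P : Measure Ω) (S : Set Ω) (f : Ω → ℝ) :
    ∫ ω, f ω ∂(cond P S) = (P.real S)⁻¹ * ∫ ω in S, f ω ∂P := by
  rw [ProbabilityTheory.cond, integral_smul_measure, ENNReal.toReal_inv, smul_eq_mul, measureReal_def]

/-- Conditioning on an event determined by the gains to the primary receiver does not change the
mean of a function of the effective gains to the secondary receiver. -/
lemma IsRayleigh.integral_cond_of_indep [IsProbabilityMeasure P] (hg : IsRayleigh P g) {N : ℕ}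
    {S : Set Ω} (hS : ∃ B, MeasurableSet B ∧ (fun ω (i : Fin N) => g (.secToPrim i) ω) ⁻¹' B = S)
    (hS0 : P.real S ≠ 0) {f : ℝ × ℝ → ℝ} (hf : Measurable f) :
    ∫ ω, f (maxBeta g N ω, g .primToSec ω) ∂(cond P S) =
      ∫ ω, f (maxBeta g N ω, g .primToSec ω) ∂P := by
  have hmeas : Measurable fun ω (i : Fin N) => g (.secToPrim i) ω :=
    measurable_pi_lambda _ fun i => hg.measurable _
  have h := Indep.setIntegral_eq_mul hmeas.comap_le (hg.indepFun_secToPrim N)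
    ((hg.measurable_maxBeta N).prodMk (hg.measurable _)).aemeasurable (A := S) hS
    hf.aestronglyMeasurable
  rw [integral_cond_eq, h, inv_mul_cancel_left₀ hS0]

/-- Being determined by the gains to the primary receiver is what lets `integral_cond_of_indep`
remove the conditioning on a regime. -/
lemma exists_preimage_unboundedRegime {Ω : Type*} (p : Params) (g : Link → Ω → ℝ) (N : ℕ) :
    ∃ B, MeasurableSet B ∧
      (fun ω (i : Fin N) => g (.secToPrim i) ω) ⁻¹' B = unboundedRegime p g N :=
  ⟨{a | ⨆ i : Fin N, p.powMu (a i) ≤ p.Pmax},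
    measurableSet_le (Measurable.iSup fun i => (measurable_pi_apply i).const_div _)
      measurable_const, rfl⟩

/-! ### The departure rate -/

namespace Params.Valid

variable {p : Params}

lemma Rp_pos (hp : p.Valid) : 0 < p.Rp :=
  div_pos (sub_pos.2 (Real.one_lt_rpow one_lt_two hp.R_pos)) hp.Pp_pos

lemma muMin_pos (hp : p.Valid) : 0 < p.muMin :=
  (mul_nonneg hp.pd_nonneg (Real.exp_pos _).le).trans_lt hp.muMin_gt

lemma level_pos (hp : p.Valid) : 0 < p.K / p.Pmax := div_pos hp.K_pos hp.Pmax_pos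

/-- The threshold `K` makes the departure rate equal to its minimum tolerable value. -/
lemma departure_at_K (hp : p.Valid) :
    p.pd * Real.exp (-p.Rp) + (1 - p.pd) * Real.exp (-(p.Rp * (1 + p.K))) = p.muMin := by
  have h1 : 0 < 1 - p.pd := sub_pos.2 hp.pd_lt_one
  have h2 : 0 < p.muMin - p.pd * Real.exp (-p.Rp) := sub_pos.2 hp.muMin_gt
  have hR := hp.Rp_pos
  have h3 : p.Rp * (1 + p.K) =
      Real.log ((1 - p.pd) / (p.muMin - p.pd * Real.exp (-p.Rp))) := by
    rw [Params.K]
    field_simp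
    ring
  rw [h3, Real.exp_neg (Real.log _), Real.exp_log (div_pos h1 h2), inv_div]
  field_simp
  ring

/-- The power control acts on the primary receiver only through this product: interference capped at
`K`. -/
lemma mul_txPower (hp : p.Valid) {a : ℝ} (ha : 0 < a) :
    a * p.txPower a = min p.K (a * p.Pmax) := by
  have hK := hp.K_pos
  have h0 : ¬ p.powMu a < 0 := not_lt.2 (div_pos hK ha).le
  rw [Params.txPower, if_neg h0]
  split_ifs with h
  · rw [Params.powMu, div_lt_iff₀ ha] at h
    rw [Params.powMu, mul_div_cancel₀ _ ha.ne', min_eq_left (by linarith)]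
  · rw [Params.powMu, div_lt_iff₀ ha, not_lt] at h
    rw [min_eq_right (by linarith)]

end Params.Valid

/-- Solved for the gain, the outage condition reads `α_p < R_p (1 + a s)`, so success is an
exponential tail. -/
lemma IsRayleigh.one_sub_outageInf [IsProbabilityMeasure P] (hg : IsRayleigh P g) {p : Params}
    (hp : p.Valid) {a s : ℝ} (has : 0 ≤ a * s) :
    1 - outageInf p P g a s = Real.exp (-(p.Rp * (1 + a * s))) := by
  have h1 : 0 < 1 + a * s := by linarith
  have hPp := hp.Pp_pos
  have hset : {ω | Real.logb 2 (1 + g .primToPrim ω * p.Pp / (1 + a * s)) < p.R} =ᵐ[P]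
      {ω | g .primToPrim ω < p.Rp * (1 + a * s)} := by
    rw [eventuallyEq_set]
    filter_upwards [hg.ae_gain_pos .primToPrim] with ω hω
    rw [Real.logb_lt_iff_lt_rpow one_lt_two (by positivity), Params.Rp, ← lt_sub_iff_add_lt',
      div_lt_iff₀ h1, div_mul_eq_mul_div, lt_div_iff₀ hPp]
  have hR := hp.Rp_pos
  rw [outageInf, measureReal_congr hset, hg.real_gain_lt _ (by positivity)]
  ring

lemma IsRayleigh.departureRate_eq [IsProbabilityMeasure P] (hg : IsRayleigh P g) {p : Params}
    (hp : p.Valid) {a s : ℝ} (has : 0 ≤ a * s) :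
    departureRate p P g a s =
      p.pd * Real.exp (-p.Rp) + (1 - p.pd) * Real.exp (-(p.Rp * (1 + a * s))) := by
  have h0 : outage p P g = outageInf p P g 0 0 := by simp [outage, outageInf]
  rw [departureRate, h0, hg.one_sub_outageInf hp has, hg.one_sub_outageInf hp (by simp)]
  simp

lemma IsRayleigh.ae_minAlpha_pos [IsProbabilityMeasure P] (hg : IsRayleigh P g) {N : ℕ}
    (hN : 0 < N) : ∀ᵐ ω ∂P, 0 < minAlpha g N ω :=
  ((hg.hasLaw_minAlpha hN).ae_iff (p := fun x => 0 < x)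
    (measurableSet_setOfPred.1 measurableSet_Ioi)).2 (ae_pos_expMeasure N)

lemma IsRayleigh.ae_departureRate_eq [IsProbabilityMeasure P] (hg : IsRayleigh P g) {p : Params}
    (hp : p.Valid) {N : ℕ} (hN : 0 < N) :
    ∀ᵐ ω ∂P, departureRate p P g (minAlpha g N ω) (p.txPower (minAlpha g N ω)) =
      p.pd * Real.exp (-p.Rp) +
        (1 - p.pd) * Real.exp (-(p.Rp * (1 + min p.K (minAlpha g N ω * p.Pmax)))) := by
  filter_upwards [hg.ae_minAlpha_pos hN] with ω hω
  have hK := hp.K_pos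
  have hm := hp.Pmax_pos
  rw [hg.departureRate_eq hp (by rw [hp.mul_txPower hω]; positivity), hp.mul_txPower hω]

lemma IsRayleigh.integrable_departureRate [IsProbabilityMeasure P] (hg : IsRayleigh P g)
    {p : Params} (hp : p.Valid) (N : ℕ) :
    Integrable (fun ω => departureRate p P g (minAlpha g N ω) (p.txPower (minAlpha g N ω))) P := by
  rcases Nat.eq_zero_or_pos N with rfl | hN
  -- With no secondary transmitters the infimum is `0` by convention and the integrand is constant.
  · simp [minAlpha]
  refine Integrable.congr ?_ ((hg.ae_departureRate_eq hp hN).mono fun _ h => h.symm)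
  refine (integrable_const _).add (Integrable.const_mul ?_ _)
  have hmeas := hg.measurable_minAlpha N
  refine Integrable.of_bound (by fun_prop) 1 ?_
  filter_upwards [hg.ae_minAlpha_pos hN] with ω hω
  have hK := hp.K_pos
  have hm := hp.Pmax_pos
  have hR := hp.Rp_pos
  rw [Real.norm_of_nonneg (Real.exp_pos _).le, Real.exp_le_one_iff]
  have : 0 ≤ min p.K (minAlpha g N ω * p.Pmax) := by positivity
  simp only [Left.neg_nonpos_iff]
  positivity

/-! ### The two regimes -/

lemma IsRayleigh.ae_mem_unboundedRegime_iff (hg : IsRayleigh P g) {p : Params} (hp : p.Valid)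
    {N : ℕ} (hN : 0 < N) :
    ∀ᵐ ω ∂P, ω ∈ unboundedRegime p g N ↔ p.K / p.Pmax ≤ minAlpha g N ω := by
  have : Nonempty (Fin N) := ⟨⟨0, hN⟩⟩
  filter_upwards [hg.ae_pos] with ω hω
  rw [unboundedRegime, Set.mem_ofPred_eq, minAlpha,
    ciSup_le_iff (Set.finite_range _).bddAbove, le_ciInf_iff (Set.finite_range _).bddBelow]
  refine forall_congr' fun i => ?_
  rw [Params.powMu, div_le_comm₀ (hω.1 i) hp.Pmax_pos]

lemma IsRayleigh.real_unboundedRegime [IsProbabilityMeasure P] (hg : IsRayleigh P g) {p : Params}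
    (hp : p.Valid) {N : ℕ} (hN : 0 < N) :
    P.real (unboundedRegime p g N) = Real.exp (-(N * (p.K / p.Pmax))) := by
  have hset : unboundedRegime p g N =ᵐ[P] {ω | p.K / p.Pmax ≤ minAlpha g N ω} :=
    eventuallyEq_set.2 (hg.ae_mem_unboundedRegime_iff hp hN)
  rw [measureReal_congr hset, (hg.hasLaw_minAlpha hN).measureReal_eq
    (p := fun x => p.K / p.Pmax ≤ x) measurableSet_Ici]
  exact expMeasure_real_Ici (Nat.cast_pos.2 hN) hp.level_pos.le

lemma IsRayleigh.real_compl_unboundedRegime [IsProbabilityMeasure P] (hg : IsRayleigh P g)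
    {p : Params} (hp : p.Valid) {N : ℕ} (hN : 0 < N) :
    P.real (unboundedRegime p g N)ᶜ = 1 - Real.exp (-(N * (p.K / p.Pmax))) := by
  rw [probReal_compl_eq_one_sub (hg.measurableSet_unboundedRegime p N),
    hg.real_unboundedRegime hp hN]

lemma IsRayleigh.real_compl_unboundedRegime_pos [IsProbabilityMeasure P] (hg : IsRayleigh P g)
    {p : Params} (hp : p.Valid) {N : ℕ} (hN : 0 < N) :
    0 < P.real (unboundedRegime p g N)ᶜ := by
  have hNr : (0 : ℝ) < N := Nat.cast_pos.2 hN
  have := hp.level_pos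
  rw [hg.real_compl_unboundedRegime hp hN, sub_pos, Real.exp_lt_one_iff]
  simp only [Left.neg_neg_iff]
  positivity

/-- In this regime the interference is pinned at `K`, so the departure rate is constant. -/
lemma IsRayleigh.meanDeparture_unbounded [IsProbabilityMeasure P] (hg : IsRayleigh P g)
    {p : Params} (hp : p.Valid) {N : ℕ} (hN : 0 < N) :
    meanDeparture p P g N (unboundedRegime p g N) = p.muMin := by
  have hS : P.real (unboundedRegime p g N) ≠ 0 := by
    rw [hg.real_unboundedRegime hp hN]
    exact (Real.exp_pos _).ne'
  have h : ∫ ω in unboundedRegime p g N,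
      departureRate p P g (minAlpha g N ω) (p.txPower (minAlpha g N ω)) ∂P =
      ∫ _ω in unboundedRegime p g N, p.muMin ∂P := by
    refine setIntegral_congr_ae (hg.measurableSet_unboundedRegime p N) ?_
    filter_upwards [hg.ae_departureRate_eq hp hN, hg.ae_mem_unboundedRegime_iff hp hN]
      with ω h1 h2 hω
    rw [h1, min_eq_left ((div_le_iff₀ hp.Pmax_pos).1 (h2.1 hω)), hp.departure_at_K]
  rw [meanDeparture, integral_cond_eq, h, setIntegral_const, smul_eq_mul, inv_mul_cancel_left₀ hS]

/-- Here the interference is `P_max A`, so the mean is a Laplace transform at `R_p P_max` of the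
exponential law of rate `N` truncated to `A < c`, divided by `1 - e^{-Nc}`. -/
lemma IsRayleigh.meanDeparture_saturated [IsProbabilityMeasure P] (hg : IsRayleigh P g)
    {p : Params} (hp : p.Valid) {N : ℕ} (hN : 0 < N) :
    meanDeparture p P g N (unboundedRegime p g N)ᶜ = MavgU p N := by
  have hNr : (0 : ℝ) < N := Nat.cast_pos.2 hN
  have := isProbabilityMeasure_expMeasure hNr
  have hlaw := hg.hasLaw_minAlpha hN
  have hS := hg.real_compl_unboundedRegime_pos hp hN
  have hR := hp.Rp_pos
  have hm := hp.Pmax_pos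
  have hK := hp.K_pos
  have hset : ((unboundedRegime p g N)ᶜ : Set Ω) =ᵐ[P]
      minAlpha g N ⁻¹' Set.Iio (p.K / p.Pmax) := by
    rw [eventuallyEq_set]
    filter_upwards [hg.ae_mem_unboundedRegime_iff hp hN] with ω h
    rw [Set.mem_compl_iff, h, not_le]
    rfl
  have hcongr : ∫ ω in minAlpha g N ⁻¹' Set.Iio (p.K / p.Pmax),
      departureRate p P g (minAlpha g N ω) (p.txPower (minAlpha g N ω)) ∂P =
      ∫ ω in minAlpha g N ⁻¹' Set.Iio (p.K / p.Pmax), (p.pd * Real.exp (-p.Rp) +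
        (1 - p.pd) * Real.exp (-p.Rp) * Real.exp (-(p.Rp * p.Pmax * minAlpha g N ω))) ∂P := by
    refine setIntegral_congr_ae (hg.measurable_minAlpha N measurableSet_Iio) ?_
    filter_upwards [hg.ae_departureRate_eq hp hN] with ω h1 hω
    rw [h1, min_eq_right ((lt_div_iff₀ hm).1 hω).le, mul_assoc (1 - p.pd), ← Real.exp_add]
    ring_nf
  have hint : IntegrableOn (fun x => Real.exp (-(p.Rp * p.Pmax * x)))
      (Set.Iio (p.K / p.Pmax)) (expMeasure N) := by
    refine Integrable.integrableOn (Integrable.of_bound (by fun_prop) 1 ?_)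
    filter_upwards [ae_pos_expMeasure (N : ℝ)] with x hx
    rw [Real.norm_of_nonneg (Real.exp_pos _).le, Real.exp_le_one_iff, Left.neg_nonpos_iff]
    positivity
  have hmap := setIntegral_map (μ := P) (g := minAlpha g N) (s := Set.Iio (p.K / p.Pmax))
    (f := fun x => p.pd * Real.exp (-p.Rp) +
        (1 - p.pd) * Real.exp (-p.Rp) * Real.exp (-(p.Rp * p.Pmax * x))) measurableSet_Iio
    (by fun_prop) hlaw.aemeasurable
  rw [hlaw.map_eq, integral_add (integrable_const _) (hint.const_mul _), setIntegral_const,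
    integral_const_mul, setIntegral_exp_neg_expMeasure hNr (by positivity) hp.level_pos.le,
    expMeasure_real_Iio hNr hp.level_pos.le] at hmap
  rw [meanDeparture, integral_cond_eq, setIntegral_congr_set hset, hcongr, ← hmap,
    hg.real_compl_unboundedRegime hp hN, MavgU]
  rw [hg.real_compl_unboundedRegime hp hN] at hS
  -- Expressed through `x = e^{-NK/P_max}` and `y = e^{-R_p K}`, the claim becomes a rational
  -- identity.
  have he1 : Real.exp (p.K * N / p.Pmax) = (Real.exp (-(N * (p.K / p.Pmax))))⁻¹ := by
    rw [← Real.exp_neg]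
    ring_nf
  have he2 : Real.exp (p.K * (p.Rp * p.Pmax + N) / p.Pmax) =
      (Real.exp (-((N + p.Rp * p.Pmax) * (p.K / p.Pmax))))⁻¹ := by
    rw [← Real.exp_neg]
    ring_nf
  have he3 : Real.exp (-((N + p.Rp * p.Pmax) * (p.K / p.Pmax))) =
      Real.exp (-(N * (p.K / p.Pmax))) * Real.exp (-(p.Rp * p.K)) := by
    rw [← Real.exp_add]
    congr 1
    field_simp
    ring
  have he4 : Real.exp (-p.Rp * (1 + p.K)) = Real.exp (-p.Rp) * Real.exp (-(p.Rp * p.K)) := by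
    rw [← Real.exp_add]
    ring_nf
  rw [he1, he2, he3, he4]
  generalize hx : Real.exp (-(N * (p.K / p.Pmax))) = x at *
  have hx0 : 0 < x := hx ▸ Real.exp_pos _
  generalize hy : Real.exp (-(p.Rp * p.K)) = y at *
  have hy0 : 0 < y := hy ▸ Real.exp_pos _
  have hd : x⁻¹ - 1 = (1 - x) / x := by field_simp
  have hd2 : (x * y)⁻¹ - 1 = (1 - x * y) / (x * y) := by field_simp
  rw [hd, hd2, smul_eq_mul]
  have hs : 0 < p.Rp * p.Pmax + N := by positivity
  have hs' : 0 < N + p.Rp * p.Pmax := by positivity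
  field_simp
  ring

lemma integrable_cond {f : Ω → ℝ} (hf : Integrable f P) {S : Set Ω} (hS : P.real S ≠ 0) :
    Integrable f (ProbabilityTheory.cond P S) := by
  refine Integrable.smul_measure hf.restrict (ENNReal.inv_ne_top.2 ?_)
  rintro h
  simp [measureReal_def, h] at hS

/-- `M_avg,u` is the mean of a departure rate that is almost surely at least `μ_min`, since the
interference never exceeds `K`. -/
lemma IsRayleigh.muMin_le_MavgU [IsProbabilityMeasure P] (hg : IsRayleigh P g)
    {p : Params} (hp : p.Valid) {N : ℕ} (hN : 0 < N) : p.muMin ≤ MavgU p N := by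
  have hS := (hg.real_compl_unboundedRegime_pos hp hN).ne'
  have : IsProbabilityMeasure (ProbabilityTheory.cond P (unboundedRegime p g N)ᶜ) :=
    cond_isProbabilityMeasure fun h => hS (by simp [measureReal_def, h])
  have hint := integrable_cond (hg.integrable_departureRate hp N) hS
  have h := integral_mono_ae (integrable_const p.muMin) hint
    (cond_absolutelyContinuous.ae_le (by
      filter_upwards [hg.ae_departureRate_eq hp hN] with ω h
      rw [h, ← hp.departure_at_K]
      have h1 : 0 ≤ 1 - p.pd := (sub_pos.2 hp.pd_lt_one).le
      have hR := hp.Rp_pos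
      gcongr
      exact min_le_left _ _))
  rw [integral_const, probReal_univ, one_smul] at h
  rw [← hg.meanDeparture_saturated hp hN]
  exact h

/-! ### The rates of the secondary network -/

/-- Rate of the scheduled secondary transmitter against interference of power `q`. -/
def rateAgainst (p : Params) (q : ℝ) (g : Link → Ω → ℝ) (N : ℕ) (ω : Ω) : ℝ :=
  Real.logb 2 (1 + snrUp p g N ω / (1 + g .primToSec ω * q))

/-- The idle rate is the case `q = 0`, so one analysis with `q ≥ 0` covers both rates. -/
lemma rateAgainst_zero {Ω : Type*} (p : Params) (g : Link → Ω → ℝ) (N : ℕ) :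
    rateAgainst p 0 g N = rateIdle p g N := by
  ext ω
  simp [rateAgainst, rateIdle]

/-- Logarithm of the total received power at the secondary receiver under maximum transmit
power. -/
def logPower (p : Params) (q : ℝ) (g : Link → Ω → ℝ) (N : ℕ) (ω : Ω) : ℝ :=
  Real.log (1 + g .primToSec ω * q + p.Pmax * maxBeta g N ω)

/-- Dividing only `y` by `1 + e` reduces `d + y` less than dividing the whole sum would, so the loss
is at most `ln(1 + e) ≤ e`. -/
lemma abs_log_one_add_div_sub_le {d y e : ℝ} (hd : 1 ≤ d) (hy : 0 ≤ y) (he : 0 ≤ e) :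
    |Real.log (1 + y / (1 + e) / d) - (Real.log (d + y) - Real.log d)| ≤ e := by
  have hd0 : 0 < d := by linarith
  have h1 : 1 + y / (1 + e) / d = (d + y / (1 + e)) / d := by field_simp
  have hy' : 0 ≤ y / (1 + e) := by positivity
  have hle : y / (1 + e) ≤ y := div_le_self hy (by linarith)
  rw [h1, Real.log_div (by linarith) hd0.ne', abs_le]
  constructor
  · have h2 : (d + y) / (1 + e) ≤ d + y / (1 + e) := by
      rw [add_div]
      linarith [div_le_self hd0.le (by linarith : 1 ≤ 1 + e)]
    have h3 := Real.log_le_log (by positivity) h2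
    rw [Real.log_div (by linarith) (by linarith)] at h3
    linarith [Real.log_le_sub_one_of_pos (by linarith : 0 < 1 + e)]
  · linarith [Real.log_le_log (by linarith) (by linarith : d + y / (1 + e) ≤ d + y)]

/-- In the unbounded regime `A = c (1 + e)`, and `K / c = P_max`; in the saturated regime `e = 0`.
-/
lemma IsRayleigh.ae_snrUp_eq [IsProbabilityMeasure P] (hg : IsRayleigh P g) {p : Params}
    (hp : p.Valid) {N : ℕ} (hN : 0 < N) :
    ∀ᵐ ω ∂P, snrUp p g N ω = p.Pmax * maxBeta g N ω /
      (1 + max (minAlpha g N ω - p.K / p.Pmax) 0 / (p.K / p.Pmax)) := by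
  filter_upwards [hg.ae_mem_unboundedRegime_iff hp hN, hg.ae_minAlpha_pos hN] with ω h hA
  have hK := hp.K_pos
  have hm := hp.Pmax_pos
  rw [snrUp]
  split_ifs with hω
  · rw [max_eq_left (sub_nonneg.2 (h.1 hω)), sub_div, div_self hp.level_pos.ne']
    field_simp
    ring
  · rw [max_eq_right (sub_nonpos.2 (not_le.1 (fun h' => hω (h.2 h'))).le)]
    simp

lemma IsRayleigh.measurable_snrUp (hg : IsRayleigh P g) (p : Params) (N : ℕ) :
    Measurable (snrUp p g N) := by
  have h1 := hg.measurable_maxBeta N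
  have h2 := hg.measurable_minAlpha N
  exact Measurable.ite (hg.measurableSet_unboundedRegime p N) (by fun_prop) (by fun_prop)

lemma IsRayleigh.measurable_logPower (hg : IsRayleigh P g) (p : Params) (q : ℝ) (N : ℕ) :
    Measurable (logPower p q g N) := by
  have h1 := hg.measurable_maxBeta N
  have h2 := hg.measurable .primToSec
  unfold logPower
  fun_prop

lemma IsRayleigh.integrable_log_one_add (hg : IsRayleigh P g) {q : ℝ} (hq : 0 ≤ q) :
    Integrable (fun ω => Real.log (1 + g .primToSec ω * q)) P := by
  have h2 := hg.measurable .primToSec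
  refine Integrable.mono' (hg.integral_primToSec.1.mul_const q)
    (by fun_prop : Measurable fun ω => Real.log (1 + g .primToSec ω * q)).aestronglyMeasurable ?_
  filter_upwards [hg.ae_gain_pos .primToSec] with ω h
  have h0 : 0 ≤ g .primToSec ω * q := by positivity
  rw [Real.norm_of_nonneg (Real.log_nonneg (by linarith))]
  linarith [Real.log_le_sub_one_of_pos (by linarith : 0 < 1 + g .primToSec ω * q)]

lemma IsRayleigh.ae_received_nonneg (hg : IsRayleigh P g) {p : Params} (hp : p.Valid)
    {q : ℝ} (hq : 0 ≤ q) (N : ℕ) :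
    ∀ᵐ ω ∂P, 0 ≤ g .primToSec ω * q ∧ 0 ≤ p.Pmax * maxBeta g N ω := by
  filter_upwards [hg.ae_gain_pos .primToSec, hg.maxBeta_nonneg_ae N] with ω h h'
  have hm := hp.Pmax_pos
  exact ⟨by positivity, by positivity⟩

lemma IsRayleigh.integrable_logPower [IsProbabilityMeasure P] (hg : IsRayleigh P g) {p : Params}
    (hp : p.Valid) {q : ℝ} (hq : 0 ≤ q) (N : ℕ) : Integrable (logPower p q g N) P := by
  refine Integrable.mono' ((hg.integral_primToSec.1.mul_const q).add
    ((hg.integrable_maxBeta N).const_mul p.Pmax))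
    (hg.measurable_logPower p q N).aestronglyMeasurable ?_
  filter_upwards [hg.ae_received_nonneg hp hq N] with ω h
  rw [logPower, Real.norm_of_nonneg (Real.log_nonneg (by linarith)), Pi.add_apply]
  linarith [Real.log_le_sub_one_of_pos
    (by linarith : 0 < 1 + g .primToSec ω * q + p.Pmax * maxBeta g N ω)]

/-- The rate at maximum power differs from the actual rate by at most a multiple of the excess of
`min_j α_{s,j}` over the level `K / P_{s,max}`. -/
lemma IsRayleigh.ae_abs_rateAgainst_sub_le [IsProbabilityMeasure P] (hg : IsRayleigh P g)
    {p : Params} (hp : p.Valid) {q : ℝ} (hq : 0 ≤ q) {N : ℕ} (hN : 0 < N) :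
    ∀ᵐ ω ∂P, |rateAgainst p q g N ω -
        (logPower p q g N ω - Real.log (1 + g .primToSec ω * q)) / Real.log 2| ≤
      max (minAlpha g N ω - p.K / p.Pmax) 0 * (1 / (p.K / p.Pmax * Real.log 2)) := by
  have hlog2 : 0 < Real.log 2 := Real.log_pos one_lt_two
  filter_upwards [hg.ae_snrUp_eq hp hN, hg.ae_received_nonneg hp hq N] with ω h h'
  have hc := hp.level_pos
  have he : 0 ≤ max (minAlpha g N ω - p.K / p.Pmax) 0 / (p.K / p.Pmax) :=
    div_nonneg (le_max_right _ _) hc.le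
  have := abs_log_one_add_div_sub_le (by linarith : 1 ≤ 1 + g .primToSec ω * q) h'.2 he
  rw [rateAgainst, logPower, h, Real.logb, ← sub_div, abs_div, abs_of_pos hlog2,
    div_le_iff₀ hlog2]
  refine this.trans_eq ?_
  field_simp

lemma IsRayleigh.integrable_posPart_minAlpha_sub [IsProbabilityMeasure P] (hg : IsRayleigh P g)
    {N : ℕ} (hN : 0 < N) {t : ℝ} (ht : 0 ≤ t) :
    Integrable (fun ω => max (minAlpha g N ω - t) 0) P ∧
      ∫ ω, max (minAlpha g N ω - t) 0 ∂P = Real.exp (-(N * t)) / N := by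
  obtain ⟨h1, h2⟩ := integral_posPart_sub_expMeasure (Nat.cast_pos.2 hN : (0 : ℝ) < N) ht
  have hl := hg.hasLaw_minAlpha hN
  rw [← hl.map_eq] at h1
  constructor
  · exact (integrable_map_measure h1.aestronglyMeasurable hl.aemeasurable).1 h1
  · rw [← h2]
    exact hl.integral_comp (f := fun x => max (x - t) 0) (by fun_prop)

lemma IsRayleigh.integrable_rateAgainst [IsProbabilityMeasure P] (hg : IsRayleigh P g)
    {p : Params} (hp : p.Valid) {q : ℝ} (hq : 0 ≤ q) (N : ℕ) :
    Integrable (rateAgainst p q g N) P := by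
  rcases Nat.eq_zero_or_pos N with rfl | hN
  · have : rateAgainst p q g 0 = fun _ => 0 := by
      ext ω
      simp [rateAgainst, snrUp, maxBeta]
    rw [this]
    exact integrable_const 0
  have hF : Integrable (fun ω =>
      (logPower p q g N ω - Real.log (1 + g .primToSec ω * q)) / Real.log 2) P :=
    ((hg.integrable_logPower hp hq N).sub (hg.integrable_log_one_add hq)).div_const _
  have h1 := hg.measurable_snrUp p N
  have h2 := hg.measurable .primToSec
  have hmeas : Measurable (rateAgainst p q g N) := by
    unfold rateAgainst Real.logb
    fun_prop
  have hdiff : Integrable (fun ω => rateAgainst p q g N ω -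
      (logPower p q g N ω - Real.log (1 + g .primToSec ω * q)) / Real.log 2) P :=
    Integrable.mono' ((hg.integrable_posPart_minAlpha_sub hN hp.level_pos.le).1.mul_const _)
      (hmeas.aestronglyMeasurable.sub hF.aestronglyMeasurable)
      (hg.ae_abs_rateAgainst_sub_le hp hq hN)
  exact (hdiff.add hF).congr (ae_of_all _ fun ω => sub_add_cancel _ _)

/-- `hexc` bounds the conditional mean excess by `1/N`; the comparison rate involves only gains to
the secondary receiver, so its conditional mean is the unconditional one. -/
lemma IsRayleigh.abs_integral_cond_rateAgainst_sub_le [IsProbabilityMeasure P]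
    (hg : IsRayleigh P g) {p : Params} (hp : p.Valid) {q : ℝ} (hq : 0 ≤ q) {N : ℕ} (hN : 0 < N)
    {S : Set Ω} (hS : ∃ B, MeasurableSet B ∧ (fun ω (i : Fin N) => g (.secToPrim i) ω) ⁻¹' B = S)
    (hS0 : 0 < P.real S)
    (hexc : ∫ ω in S, max (minAlpha g N ω - p.K / p.Pmax) 0 ∂P ≤ P.real S / N) :
    |∫ ω, rateAgainst p q g N ω ∂(ProbabilityTheory.cond P S) -
      (∫ ω, logPower p q g N ω ∂P - ∫ ω, Real.log (1 + g .primToSec ω * q) ∂P) / Real.log 2| ≤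
      1 / (p.K / p.Pmax * Real.log 2) * (N : ℝ)⁻¹ := by
  have hlog2 : 0 < Real.log 2 := Real.log_pos one_lt_two
  have hc := hp.level_pos
  have hNr : (0 : ℝ) < N := Nat.cast_pos.2 hN
  have hF := (hg.integrable_logPower hp hq N).sub (hg.integrable_log_one_add hq)
  have hF' : Integrable (fun ω =>
      (logPower p q g N ω - Real.log (1 + g .primToSec ω * q)) / Real.log 2) P := hF.div_const _
  have hA := (hg.integrable_posPart_minAlpha_sub hN hp.level_pos.le).1
  have hind := hg.integral_cond_of_indep hS hS0.ne' (f := fun x =>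
    (Real.log (1 + x.2 * q + p.Pmax * x.1) - Real.log (1 + x.2 * q)) / Real.log 2) (by fun_prop)
  have heq : (∫ ω, logPower p q g N ω ∂P - ∫ ω, Real.log (1 + g .primToSec ω * q) ∂P) /
      Real.log 2 = ∫ ω, (logPower p q g N ω - Real.log (1 + g .primToSec ω * q)) / Real.log 2
        ∂(ProbabilityTheory.cond P S) := by
    refine Eq.trans ?_ hind.symm
    rw [← integral_sub (hg.integrable_logPower hp hq N) (hg.integrable_log_one_add hq),
      ← integral_div]
    rfl
  rw [heq, ← integral_sub (integrable_cond (hg.integrable_rateAgainst hp hq N) hS0.ne')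
    (integrable_cond hF' hS0.ne')]
  have hbound := (cond_absolutelyContinuous (μ := P) (s := S)).ae_le
    (hg.ae_abs_rateAgainst_sub_le hp hq hN)
  rw [← Real.norm_eq_abs]
  refine le_trans (norm_integral_le_of_norm_le (integrable_cond
    (hA.mul_const (1 / (p.K / p.Pmax * Real.log 2))) hS0.ne') hbound) ?_
  rw [integral_mul_const, integral_cond_eq, mul_comm]
  refine mul_le_mul_of_nonneg_left ?_ (by positivity)
  rw [inv_mul_le_iff₀ hS0]
  exact hexc

/-- Absence of memory: the total mean excess `e^{-Nc} / N` is exactly the probability of the regime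
divided by `N`. -/
lemma IsRayleigh.setIntegral_excess_unbounded_le [IsProbabilityMeasure P] (hg : IsRayleigh P g)
    {p : Params} (hp : p.Valid) {N : ℕ} (hN : 0 < N) :
    ∫ ω in unboundedRegime p g N, max (minAlpha g N ω - p.K / p.Pmax) 0 ∂P ≤
      P.real (unboundedRegime p g N) / N := by
  obtain ⟨h1, h2⟩ := hg.integrable_posPart_minAlpha_sub hN hp.level_pos.le
  rw [hg.real_unboundedRegime hp hN, ← h2]
  exact setIntegral_le_integral h1 (ae_of_all _ fun _ => le_max_right _ _)

lemma IsRayleigh.setIntegral_excess_saturated_le [IsProbabilityMeasure P] (hg : IsRayleigh P g)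
    {p : Params} (hp : p.Valid) {N : ℕ} (hN : 0 < N) :
    ∫ ω in (unboundedRegime p g N)ᶜ, max (minAlpha g N ω - p.K / p.Pmax) 0 ∂P ≤
      P.real (unboundedRegime p g N)ᶜ / N := by
  have h : ∫ ω in (unboundedRegime p g N)ᶜ, max (minAlpha g N ω - p.K / p.Pmax) 0 ∂P = 0 := by
    refine (setIntegral_congr_ae (hg.measurableSet_unboundedRegime p N).compl ?_).trans
      (integral_zero _ _)
    filter_upwards [hg.ae_mem_unboundedRegime_iff hp hN] with ω h hω
    exact max_eq_right (sub_nonpos.2 (not_le.1 fun h' => hω (h.2 h')).le)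
  rw [h]
  positivity

/-! ### Asymptotics -/

lemma tendsto_log_one_add_mul_sub_log {m : ℝ} (hm : 0 < m) :
    Tendsto (fun y : ℝ => Real.log (1 + m * y) - Real.log (m * y)) atTop (𝓝 0) := by
  have h1 : Tendsto (fun y : ℝ => (m * y)⁻¹ + 1) atTop (𝓝 1) := by
    simpa using (tendsto_inv_atTop_zero.comp (tendsto_id.const_mul_atTop hm)).add_const 1
  have h2 := (Real.continuousAt_log one_ne_zero).tendsto.comp h1
  rw [Real.log_one] at h2
  refine h2.congr' ?_
  filter_upwards [eventually_gt_atTop 0] with y hy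
  have hmy : 0 < m * y := mul_pos hm hy
  rw [← Real.log_div (by linarith) hmy.ne', Function.comp_apply]
  congr 1
  field_simp

/-- Since `ln y = o(y)`, the two arguments have ratio tending to `1`. It is applied with `y = ln N`.
-/
lemma tendsto_log_one_add_mul_sub_log_sub {m : ℝ} (hm : 0 < m) :
    Tendsto (fun y : ℝ => Real.log (1 + m * y) - Real.log (1 + m * (y - Real.log y)))
      atTop (𝓝 0) := by
  have hlog : Tendsto (fun y : ℝ => Real.log y / y) atTop (𝓝 0) :=
    Real.isLittleO_log_id_atTop.tendsto_div_nhds_zero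
  have h1 : Tendsto (fun y : ℝ => (y⁻¹ + m) / (y⁻¹ + m * (1 - Real.log y / y))) atTop (𝓝 1) := by
    have := (tendsto_inv_atTop_zero.add_const m).div
      (tendsto_inv_atTop_zero.add ((hlog.const_sub 1).const_mul m)) (by simpa using hm.ne')
    simpa [div_self hm.ne', Pi.div_def] using this
  have h2 := (Real.continuousAt_log one_ne_zero).tendsto.comp h1
  rw [Real.log_one] at h2
  refine h2.congr' ?_
  filter_upwards [eventually_gt_atTop 0] with y hy
  have hmy : 0 < m * y := mul_pos hm hy
  have hle : 0 ≤ m * (y - Real.log y) :=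
    mul_nonneg hm.le (by linarith [Real.log_le_sub_one_of_pos hy])
  rw [← Real.log_div (by linarith) (by linarith), Function.comp_apply]
  congr 1
  have h3 : y⁻¹ + m * (1 - Real.log y / y) = (1 + m * (y - Real.log y)) / y := by
    field_simp
  have h4 : y⁻¹ + m = (1 + m * y) / y := by field_simp
  rw [h3, h4, div_div_div_cancel_right₀ hy.ne']

lemma tendsto_log_natCast_atTop : Tendsto (fun N : ℕ => Real.log N) atTop atTop :=
  Real.tendsto_log_atTop.comp tendsto_natCast_atTop_atTop

lemma IsRayleigh.integral_logPower_le [IsProbabilityMeasure P] (hg : IsRayleigh P g) {p : Params}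
    (hp : p.Valid) {q : ℝ} (hq : 0 ≤ q) {N : ℕ} (hN : 0 < N) :
    ∫ ω, logPower p q g N ω ∂P ≤
      Real.log (1 + p.Pmax * Real.log N) + (q + p.Pmax) / (1 + p.Pmax * Real.log N) := by
  have hm := hp.Pmax_pos
  have hlog : 0 ≤ Real.log N := Real.log_natCast_nonneg N
  set t := 1 + p.Pmax * Real.log N with ht
  have ht0 : 0 < t := by positivity
  have hb := hg.integral_primToSec
  have hX := hg.integrable_maxBeta N
  have hint : Integrable (fun ω => g .primToSec ω * q + p.Pmax * maxBeta g N ω) P :=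
    (hb.1.mul_const q).add (hX.const_mul _)
  -- The concave logarithm lies below its tangent at `t`.
  have hle : ∫ ω, logPower p q g N ω ∂P ≤ ∫ ω, (Real.log t + (1 - t) / t +
      (g .primToSec ω * q + p.Pmax * maxBeta g N ω) / t) ∂P := by
    refine integral_mono_ae (hg.integrable_logPower hp hq N)
      ((integrable_const _).add (hint.div_const t)) ?_
    filter_upwards [hg.ae_received_nonneg hp hq N] with ω h
    have hy : 0 < 1 + g .primToSec ω * q + p.Pmax * maxBeta g N ω := by linarith
    have := Real.log_le_sub_one_of_pos (div_pos hy ht0)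
    rw [Real.log_div hy.ne' ht0.ne'] at this
    have h' : (1 + g .primToSec ω * q + p.Pmax * maxBeta g N ω) / t - 1 =
      (1 - t) / t + (g .primToSec ω * q + p.Pmax * maxBeta g N ω) / t := by
      field_simp
      ring
    rw [logPower]
    linarith
  rw [integral_add (integrable_const _) (hint.div_const t), integral_const, probReal_univ, one_smul,
    integral_div, integral_add (hb.1.mul_const q) (hX.const_mul _), integral_mul_const,
    integral_const_mul, hb.2] at hle
  refine hle.trans ?_
  have hmean : 1 - t + (1 * q + p.Pmax * ∫ ω, maxBeta g N ω ∂P) ≤ q + p.Pmax := by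
    nlinarith [hg.integral_maxBeta_le hN]
  rw [add_assoc, ← add_div]
  linarith [div_le_div_of_nonneg_right hmean ht0.le]

lemma IsRayleigh.le_integral_logPower [IsProbabilityMeasure P] (hg : IsRayleigh P g) {p : Params}
    (hp : p.Valid) {q : ℝ} (hq : 0 ≤ q) {N : ℕ} (hN : 1 ≤ Real.log N) :
    Real.log (1 + p.Pmax * (Real.log N - Real.log (Real.log N))) - p.Pmax * (Real.log N / N) ≤
      ∫ ω, logPower p q g N ω ∂P := by
  have hm := hp.Pmax_pos
  have hNr : (0 : ℝ) < N := by
    rcases Nat.eq_zero_or_pos N with rfl | h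
    · norm_num at hN
    · exact Nat.cast_pos.2 h
  have hlog : 0 < Real.log N := by linarith
  have hll : 0 ≤ Real.log (Real.log N) := Real.log_nonneg hN
  -- With this threshold `N e^{-s} = ln N`, so the tail bound `exp(-N e^{-s})` is exactly `1/N`,
  -- while the loss on the exceptional event is only `O(ln N)`.
  set s := Real.log N - Real.log (Real.log N) with hs
  have hs0 : 0 ≤ s := by linarith [Real.log_le_sub_one_of_pos hlog]
  have hprob : P.real {ω | maxBeta g N ω < s} ≤ (N : ℝ)⁻¹ := by
    refine (hg.real_maxBeta_lt_le hs0).trans_eq ?_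
    rw [hs, neg_sub, Real.exp_sub, Real.exp_log hlog, Real.exp_log hNr, mul_div_cancel₀ _ hNr.ne',
      Real.exp_neg, Real.exp_log hNr]
  have hlogs : 0 ≤ Real.log (1 + p.Pmax * s) := Real.log_nonneg (by nlinarith)
  have hlogs' : Real.log (1 + p.Pmax * s) ≤ p.Pmax * Real.log N := by
    have := Real.log_le_sub_one_of_pos (by positivity : 0 < 1 + p.Pmax * s)
    nlinarith
  have hmeas : MeasurableSet {ω | maxBeta g N ω < s} :=
    hg.measurable_maxBeta N measurableSet_Iio
  have hind : Integrable ({ω | maxBeta g N ω < s}.indicator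
      fun _ => Real.log (1 + p.Pmax * s)) P := (integrable_const _).indicator hmeas
  have hle : ∫ ω, (Real.log (1 + p.Pmax * s) -
      {ω | maxBeta g N ω < s}.indicator (fun _ => Real.log (1 + p.Pmax * s)) ω) ∂P ≤
      ∫ ω, logPower p q g N ω ∂P := by
    refine integral_mono_ae ((integrable_const _).sub hind) (hg.integrable_logPower hp hq N) ?_
    filter_upwards [hg.ae_received_nonneg hp hq N] with ω h
    rw [logPower]
    by_cases hω : ω ∈ {ω | maxBeta g N ω < s}
    · rw [Set.indicator_of_mem hω, sub_self]
      exact Real.log_nonneg (by linarith)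
    · rw [Set.indicator_of_notMem hω, sub_zero]
      refine Real.log_le_log (by positivity) ?_
      have hge : s ≤ maxBeta g N ω := not_lt.1 hω
      nlinarith
  rw [integral_sub (integrable_const _) hind, integral_const, probReal_univ, one_smul,
    integral_indicator_const _ hmeas, smul_eq_mul] at hle
  refine le_trans ?_ hle
  have : P.real {ω | maxBeta g N ω < s} * Real.log (1 + p.Pmax * s) ≤
      (N : ℝ)⁻¹ * (p.Pmax * Real.log N) := mul_le_mul hprob hlogs' hlogs (by positivity)
  have h' : p.Pmax * (Real.log N / N) = (N : ℝ)⁻¹ * (p.Pmax * Real.log N) := by ring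
  rw [h']
  linarith

lemma IsRayleigh.tendsto_integral_logPower_sub [IsProbabilityMeasure P] (hg : IsRayleigh P g)
    {p : Params} (hp : p.Valid) {q : ℝ} (hq : 0 ≤ q) :
    Tendsto (fun N : ℕ => ∫ ω, logPower p q g N ω ∂P - Real.log (1 + p.Pmax * Real.log N))
      atTop (𝓝 0) := by
  have hm := hp.Pmax_pos
  have hupper : Tendsto (fun N : ℕ => (q + p.Pmax) / (1 + p.Pmax * Real.log N)) atTop (𝓝 0) :=
    (tendsto_atTop_add_const_left _ 1
      (tendsto_log_natCast_atTop.const_mul_atTop hm)).const_div_atTop _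
  have hdiv : Tendsto (fun N : ℕ => Real.log N / (N : ℝ)) atTop (𝓝 0) :=
    Real.isLittleO_log_id_atTop.tendsto_div_nhds_zero.comp tendsto_natCast_atTop_atTop
  have hlower : Tendsto (fun N : ℕ => -(Real.log (1 + p.Pmax * Real.log N) -
      Real.log (1 + p.Pmax * (Real.log N - Real.log (Real.log N)))) -
      p.Pmax * (Real.log N / N)) atTop (𝓝 0) := by
    simpa using ((tendsto_log_one_add_mul_sub_log_sub hm).comp tendsto_log_natCast_atTop).neg.sub
      (hdiv.const_mul p.Pmax)
  refine tendsto_of_tendsto_of_tendsto_of_le_of_le' hlower hupper ?_ ?_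
  · filter_upwards [tendsto_log_natCast_atTop.eventually_ge_atTop 1] with N hN
    linarith [hg.le_integral_logPower hp hq hN]
  · filter_upwards [eventually_gt_atTop 0] with N hN
    linarith [hg.integral_logPower_le hp hq hN]

/-- Mean rate conditioned on events that depend only on the gains to the primary receiver. -/
lemma IsRayleigh.tendsto_integral_cond_rateAgainst_sub [IsProbabilityMeasure P]
    (hg : IsRayleigh P g) {p : Params} (hp : p.Valid) {q : ℝ} (hq : 0 ≤ q) {S : ℕ → Set Ω}
    (hS : ∀ N, ∃ B, MeasurableSet B ∧ (fun ω (i : Fin N) => g (.secToPrim i) ω) ⁻¹' B = S N)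
    (hS0 : ∀ N, 0 < N → 0 < P.real (S N))
    (hexc : ∀ N, 0 < N →
      ∫ ω in S N, max (minAlpha g N ω - p.K / p.Pmax) 0 ∂P ≤ P.real (S N) / N) :
    Tendsto (fun N : ℕ => ∫ ω, rateAgainst p q g N ω ∂(ProbabilityTheory.cond P (S N)) -
      (Real.logb 2 (1 + p.Pmax * Real.log N) -
        (∫ ω, Real.log (1 + g .primToSec ω * q) ∂P) / Real.log 2)) atTop (𝓝 0) := by
  have h1 : Tendsto (fun N : ℕ => ∫ ω, rateAgainst p q g N ω ∂(ProbabilityTheory.cond P (S N)) -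
      (∫ ω, logPower p q g N ω ∂P - ∫ ω, Real.log (1 + g .primToSec ω * q) ∂P) / Real.log 2)
      atTop (𝓝 0) := by
    refine squeeze_zero_norm' (a := fun N : ℕ => 1 / (p.K / p.Pmax * Real.log 2) * (N : ℝ)⁻¹) ?_
      (by simpa using tendsto_inv_atTop_nhds_zero_nat.const_mul (1 / (p.K / p.Pmax * Real.log 2)))
    filter_upwards [eventually_gt_atTop 0] with N hN
    exact hg.abs_integral_cond_rateAgainst_sub_le hp hq hN (hS N) (hS0 N hN) (hexc N hN)
  have h2 := h1.add ((hg.tendsto_integral_logPower_sub hp hq).div_const (Real.log 2))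
  rw [zero_div, add_zero] at h2
  refine h2.congr fun N => ?_
  rw [Real.logb]
  ring

/-! ### Averaging over the traffic -/

lemma trafficAverage_sub (p : Params) (m a b a' b' : ℝ) :
    trafficAverage p m a b - trafficAverage p m a' b' = trafficAverage p m (a - a') (b - b') := by
  unfold trafficAverage
  ring

/-- `λ / m` may exceed `1`, so the idle coefficient may be negative; `m ≥ μ_min` still bounds both
coefficients. -/
lemma abs_trafficAverage_le {p : Params} (hp : p.Valid) {m : ℝ} (hm : p.muMin ≤ m) (a b : ℝ) :
    |trafficAverage p m a b| ≤ (1 + 1 / p.muMin) * (|a| + |b|) := by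
  have hmu := hp.muMin_pos
  have h0 : 0 ≤ p.lam / m := div_nonneg hp.lam_nonneg (hmu.le.trans hm)
  have h1 : p.lam / m ≤ 1 / p.muMin := div_le_div₀ zero_le_one hp.lam_le_one hmu hm
  have hd0 := hp.pd_nonneg
  have hd1 := hp.pd_lt_one
  have hf0 := hp.pf_nonneg
  have hf1 := hp.pf_le_one
  have ha : |p.lam / m * (1 - p.pd)| ≤ 1 + 1 / p.muMin := by
    rw [abs_of_nonneg (mul_nonneg h0 (by linarith))]
    nlinarith
  have hb : |(1 - p.lam / m) * (1 - p.pf)| ≤ 1 + 1 / p.muMin := by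
    rw [abs_mul, abs_of_nonneg (by linarith : 0 ≤ 1 - p.pf)]
    have : |1 - p.lam / m| ≤ 1 + 1 / p.muMin := abs_le.2 ⟨by linarith, by linarith⟩
    nlinarith [abs_nonneg (1 - p.lam / m)]
  unfold trafficAverage
  refine (abs_add_le _ _).trans ?_
  rw [abs_mul, abs_mul _ b, mul_add]
  gcongr

lemma tendsto_trafficAverage {p : Params} (hp : p.Valid) {m a b : ℕ → ℝ}
    (hm : ∀ᶠ N in atTop, p.muMin ≤ m N) (ha : Tendsto a atTop (𝓝 0))
    (hb : Tendsto b atTop (𝓝 0)) :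
    Tendsto (fun N => trafficAverage p (m N) (a N) (b N)) atTop (𝓝 0) := by
  refine squeeze_zero_norm' (a := fun N => (1 + 1 / p.muMin) * (|a N| + |b N|)) ?_
    (by simpa using (ha.abs.add hb.abs).const_mul (1 + 1 / p.muMin))
  filter_upwards [hm] with N hN using abs_trafficAverage_le hp hN _ _

lemma asympUnbounded_eq (p : Params) (N : ℕ) :
    asympUnbounded p N = trafficAverage p p.muMin
      (Real.logb 2 (p.Pmax * Real.log N) - interferenceLoss p)
      (Real.logb 2 (p.Pmax * Real.log N)) := rfl

lemma asympSaturated_eq (p : Params) (N : ℕ) :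
    asympSaturated p N = trafficAverage p (MavgU p N)
      (Real.logb 2 (1 + p.Pmax * Real.log N) - interferenceLoss p)
      (Real.logb 2 (1 + p.Pmax * Real.log N)) := rfl

lemma IsRayleigh.tendsto_mean_rates [IsProbabilityMeasure P] (hg : IsRayleigh P g) {p : Params}
    (hp : p.Valid) {S : ℕ → Set Ω}
    (hS : ∀ N, ∃ B, MeasurableSet B ∧ (fun ω (i : Fin N) => g (.secToPrim i) ω) ⁻¹' B = S N)
    (hS0 : ∀ N, 0 < N → 0 < P.real (S N))
    (hexc : ∀ N, 0 < N →
      ∫ ω in S N, max (minAlpha g N ω - p.K / p.Pmax) 0 ∂P ≤ P.real (S N) / N) :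
    Tendsto (fun N : ℕ => ∫ ω, rateBusy p g N ω ∂(ProbabilityTheory.cond P (S N)) -
      (Real.logb 2 (1 + p.Pmax * Real.log N) - interferenceLoss p)) atTop (𝓝 0) ∧
    Tendsto (fun N : ℕ => ∫ ω, rateIdle p g N ω ∂(ProbabilityTheory.cond P (S N)) -
      Real.logb 2 (1 + p.Pmax * Real.log N)) atTop (𝓝 0) := by
  have hbusy := hg.tendsto_integral_cond_rateAgainst_sub hp hp.Pp_pos.le hS hS0 hexc
  have hidle := hg.tendsto_integral_cond_rateAgainst_sub hp le_rfl hS hS0 hexc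
  rw [hg.integral_log_one_add_primToSec hp.Pp_pos] at hbusy
  simp only [rateAgainst_zero, mul_zero, add_zero, Real.log_one, integral_zero, zero_div,
    sub_zero] at hidle
  exact ⟨hbusy, hidle⟩

lemma IsRayleigh.real_unboundedRegime_pos [IsProbabilityMeasure P] (hg : IsRayleigh P g) {p : Params}
    (hp : p.Valid) {N : ℕ} (hN : 0 < N) :
    0 < P.real (unboundedRegime p g N) := by
  rw [hg.real_unboundedRegime hp hN]
  exact Real.exp_pos _

lemma tendsto_logb_one_add_sub_logb {m : ℝ} (hm : 0 < m) :
    Tendsto (fun N : ℕ => Real.logb 2 (1 + m * Real.log N) - Real.logb 2 (m * Real.log N))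
      atTop (𝓝 0) := by
  have h := ((tendsto_log_one_add_mul_sub_log hm).comp tendsto_log_natCast_atTop).div_const
    (Real.log 2)
  rw [zero_div] at h
  refine h.congr fun N => ?_
  simp only [Function.comp_apply, Real.logb]
  ring

theorem IsRayleigh.tendsto_condCapacityUp_unbounded_sub [IsProbabilityMeasure P] (hg : IsRayleigh P g) {p : Params}
    (hp : p.Valid) :
    Tendsto (fun N : ℕ => condCapacityUp p P g N (unboundedRegime p g N) - asympUnbounded p N)
      atTop (𝓝 0) := by
  obtain ⟨hb, hi⟩ := hg.tendsto_mean_rates hp (exists_preimage_unboundedRegime p g)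
    (fun N hN => hg.real_unboundedRegime_pos hp hN)
    (fun N hN => hg.setIntegral_excess_unbounded_le hp hN)
  -- `T₁` is written without the `1 +` inside its logarithms; the difference is `o(1)`.
  have hl := tendsto_logb_one_add_sub_logb hp.Pmax_pos
  have hb' := hb.add hl
  have hi' := hi.add hl
  rw [add_zero] at hb' hi'
  refine (tendsto_trafficAverage hp (Eventually.of_forall fun _ => le_refl p.muMin) hb' hi').congr' ?_
  filter_upwards [eventually_gt_atTop 0] with N hN
  rw [condCapacityUp, hg.meanDeparture_unbounded hp hN, asympUnbounded_eq, trafficAverage_sub]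
  congr 1 <;> ring

theorem IsRayleigh.tendsto_condCapacityUp_saturated_sub [IsProbabilityMeasure P] (hg : IsRayleigh P g) {p : Params}
    (hp : p.Valid) :
    Tendsto (fun N : ℕ => condCapacityUp p P g N (unboundedRegime p g N)ᶜ - asympSaturated p N)
      atTop (𝓝 0) := by
  have hS : ∀ N, ∃ B, MeasurableSet B ∧
      (fun ω (i : Fin N) => g (.secToPrim i) ω) ⁻¹' B = (unboundedRegime p g N)ᶜ := fun N => by
    obtain ⟨B, hB, h⟩ := exists_preimage_unboundedRegime p g N
    exact ⟨Bᶜ, hB.compl, by rw [Set.preimage_compl, h]⟩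
  obtain ⟨hb, hi⟩ := hg.tendsto_mean_rates hp hS
    (fun N hN => hg.real_compl_unboundedRegime_pos hp hN)
    (fun N hN => hg.setIntegral_excess_saturated_le hp hN)
  have hm : ∀ᶠ N in atTop, p.muMin ≤ MavgU p N := by
    filter_upwards [eventually_gt_atTop 0] with N hN using hg.muMin_le_MavgU hp hN
  refine (tendsto_trafficAverage hp hm hb hi).congr' ?_
  filter_upwards [eventually_gt_atTop 0] with N hN
  rw [condCapacityUp, hg.meanDeparture_saturated hp hN, asympSaturated_eq, trafficAverage_sub]

/-! ### The mixture of the two regimes -/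

/-- From `-ln(1 - 1/N) ≤ 1/(N - 1)` the exponent of the weight is at most `-(K / P_max)(N - 1)`. -/
lemma weight_le {p : Params} (hp : p.Valid) {N : ℕ} (hN : 2 ≤ N) :
    weight p N ≤ Real.exp (p.K / p.Pmax) * Real.exp (-(p.K / p.Pmax * N)) := by
  have hc := hp.level_pos
  have hNr : (2 : ℝ) ≤ N := by exact_mod_cast hN
  have hinv : 1 / (N : ℝ) < 1 := by
    rw [div_lt_one (by linarith)]
    linarith
  have hpos : 0 < 1 - 1 / (N : ℝ) := by linarith
  have hlog : -Real.log (1 - 1 / (N : ℝ)) ≤ 1 / (N - 1) := by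
    rw [← Real.log_inv]
    refine (Real.log_le_sub_one_of_pos (inv_pos.2 hpos)).trans_eq ?_
    have h1 : (N : ℝ) - 1 ≠ 0 := by linarith
    have h2 : (N : ℝ) ≠ 0 := by linarith
    field_simp
    ring
  have hneg : Real.log (1 - 1 / (N : ℝ)) < 0 :=
    Real.log_neg hpos (by linarith [one_div_pos.2 (by linarith : (0 : ℝ) < N)])
  have hinvlog : (N : ℝ) - 1 ≤ (-Real.log (1 - 1 / (N : ℝ)))⁻¹ := by
    rw [le_inv_comm₀ (by linarith) (by linarith), ← one_div]
    exact hlog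
  rw [weight, ← Real.exp_add, Real.exp_le_exp, ← div_div]
  rw [div_eq_mul_inv _ (Real.log _), ← neg_neg (Real.log _)⁻¹, ← inv_neg]
  nlinarith

lemma tendsto_natCast_mul_exp_neg {c : ℝ} (hc : 0 < c) :
    Tendsto (fun N : ℕ => (N : ℝ) * Real.exp (-(c * N))) atTop (𝓝 0) := by
  have h := ((Real.tendsto_pow_mul_exp_neg_atTop_nhds_zero 1).comp
    ((tendsto_id.const_mul_atTop hc).comp tendsto_natCast_atTop_atTop)).const_mul c⁻¹
  rw [mul_zero] at h
  refine h.congr fun N => ?_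
  simp only [Function.comp_apply, id, pow_one]
  field_simp

lemma IsRayleigh.exists_asymp_sub_le [IsProbabilityMeasure P] (hg : IsRayleigh P g) {p : Params}
    (hp : p.Valid) :
    ∃ C, ∀ᶠ N : ℕ in atTop, |asympUnbounded p N - asympSaturated p N| ≤ C * N := by
  have hm := hp.Pmax_pos
  have hmu := hp.muMin_pos
  have hlog2 : 0 < Real.log 2 := Real.log_pos one_lt_two
  have hl := (tendsto_logb_one_add_sub_logb hm).abs
  rw [abs_zero] at hl
  set L := |interferenceLoss p|
  -- From `|u| ≤ |v| + 1`, the four absolute values sum to at most `4|v| + 2 + 2L`; then `|v| ≤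
  -- (P_max / ln 2) N`, and `N ≥ 1` absorbs the constants. This crude bound suffices against
  -- exponentially small weights.
  refine ⟨(1 + 1 / p.muMin) * (4 * (p.Pmax / Real.log 2) + 2 + 2 * L), ?_⟩
  filter_upwards [eventually_gt_atTop 0, hl.eventually_lt_const one_pos] with N hN hlN
  have hNr : (1 : ℝ) ≤ N := by exact_mod_cast hN
  set v := Real.logb 2 (1 + p.Pmax * Real.log N) with hv
  set u := Real.logb 2 (p.Pmax * Real.log N) with hu
  have hlogN : 0 ≤ Real.log N := Real.log_natCast_nonneg N
  have hvle : |v| ≤ p.Pmax / Real.log 2 * N := by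
    have h0 : 0 ≤ p.Pmax * Real.log N := by positivity
    rw [hv, Real.logb, abs_of_nonneg (div_nonneg (Real.log_nonneg (by linarith)) hlog2.le),
      div_mul_eq_mul_div]
    gcongr
    have h1 := Real.log_le_sub_one_of_pos (by linarith : 0 < 1 + p.Pmax * Real.log N)
    have h2 := Real.log_le_sub_one_of_pos (by linarith : (0 : ℝ) < N)
    nlinarith
  have hule : |u| ≤ |v| + 1 := by
    have := abs_sub_abs_le_abs_sub u v
    rw [abs_sub_comm] at this
    linarith
  have h1 : |asympUnbounded p N| ≤ (1 + 1 / p.muMin) * (|u - interferenceLoss p| + |u|) :=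
    abs_trafficAverage_le hp le_rfl _ _
  have h2 : |asympSaturated p N| ≤ (1 + 1 / p.muMin) * (|v - interferenceLoss p| + |v|) :=
    abs_trafficAverage_le hp (hg.muMin_le_MavgU hp hN) _ _
  have h3 : |u - interferenceLoss p| ≤ |u| + L := abs_sub _ _
  have h4 : |v - interferenceLoss p| ≤ |v| + L := abs_sub _ _
  have hL : 0 ≤ L := abs_nonneg _
  calc |asympUnbounded p N - asympSaturated p N|
      ≤ |asympUnbounded p N| + |asympSaturated p N| := abs_sub _ _
    _ ≤ (1 + 1 / p.muMin) * ((|u - interferenceLoss p| + |u|) +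
          (|v - interferenceLoss p| + |v|)) := by rw [mul_add]; exact add_le_add h1 h2
    _ ≤ (1 + 1 / p.muMin) * ((4 * (p.Pmax / Real.log 2) + 2 + 2 * L) * N) := by
        gcongr
        nlinarith
    _ = _ := by ring

lemma IsRayleigh.tendsto_weight_sub_mul [IsProbabilityMeasure P] (hg : IsRayleigh P g) {p : Params}
    (hp : p.Valid) :
    Tendsto (fun N : ℕ => (P.real (unboundedRegime p g N) - weight p N) *
      (asympUnbounded p N - asympSaturated p N)) atTop (𝓝 0) := by
  obtain ⟨C, hC⟩ := hg.exists_asymp_sub_le hp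
  set c := p.K / p.Pmax with hc
  have hlim := (tendsto_natCast_mul_exp_neg hp.level_pos).const_mul ((1 + Real.exp c) * C)
  rw [mul_zero] at hlim
  refine squeeze_zero_norm' ?_ hlim
  filter_upwards [hC, eventually_ge_atTop 2] with N hN hN2
  have hw0 : 0 < weight p N := Real.exp_pos _
  have hw := weight_le hp hN2
  have hr : P.real (unboundedRegime p g N) = Real.exp (-(c * N)) := by
    rw [hg.real_unboundedRegime hp (by omega), mul_comm]
  have hd : |P.real (unboundedRegime p g N) - weight p N| ≤
      (1 + Real.exp c) * Real.exp (-(c * N)) := by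
    rw [hr]
    have he := Real.exp_pos (-(c * N))
    have he' := Real.exp_pos c
    rw [abs_le]
    constructor <;> nlinarith
  rw [norm_mul, Real.norm_eq_abs, Real.norm_eq_abs]
  calc _ ≤ (1 + Real.exp c) * Real.exp (-(c * N)) * (C * N) :=
        mul_le_mul hd hN (abs_nonneg _) (by positivity)
    _ = _ := by ring

lemma IsRayleigh.tendsto_real_unboundedRegime [IsProbabilityMeasure P] (hg : IsRayleigh P g) {p : Params}
    (hp : p.Valid) :
    Tendsto (fun N : ℕ => P.real (unboundedRegime p g N)) atTop (𝓝 0) := by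
  have h := Real.tendsto_exp_neg_atTop_nhds_zero.comp
    ((tendsto_id.atTop_mul_const hp.level_pos).comp tendsto_natCast_atTop_atTop)
  refine h.congr' ?_
  filter_upwards [eventually_gt_atTop 0] with N hN
  rw [hg.real_unboundedRegime hp hN]
  rfl

theorem IsRayleigh.tendsto_capacityUp_sub [IsProbabilityMeasure P] (hg : IsRayleigh P g) {p : Params}
    (hp : p.Valid) :
    Tendsto (fun N : ℕ => capacityUp p P g N -
      (weight p N * asympUnbounded p N + (1 - weight p N) * asympSaturated p N))
      atTop (𝓝 0) := by
  have hprob := hg.tendsto_real_unboundedRegime hp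
  -- The error splits as `Pr[A₁](E[C⁽¹⁾] - T₁) + Pr[A₂](E[C⁽²⁾] - T₂) + (Pr[A₁] - w_N)(T₁ - T₂)`.
  have h := ((hprob.mul (hg.tendsto_condCapacityUp_unbounded_sub hp)).add
    ((hprob.const_sub 1).mul (hg.tendsto_condCapacityUp_saturated_sub hp))).add
    (hg.tendsto_weight_sub_mul hp)
  simp only [mul_zero, add_zero] at h
  refine h.congr fun N => ?_
  rw [capacityUp, probReal_compl_eq_one_sub (hg.measurableSet_unboundedRegime p N)]
  ring

end CognitiveRadio

end

open MeasureTheory ProbabilityTheory Filter Topology CognitiveRadio in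
theorem theorem2 {Ω : Type*} [MeasurableSpace Ω] (P : Measure Ω) [IsProbabilityMeasure P]
    (g : Link → Ω → ℝ) (hg : IsRayleigh P g) (p : Params) (hp : p.Valid) :
    -- the expectations in the average capacity exist
    (∀ N : ℕ, Integrable (rateIdle p g N) P ∧ Integrable (rateBusy p g N) P ∧
      Integrable (fun ω => departureRate p P g (minAlpha g N ω) (p.txPower (minAlpha g N ω))) P) ∧
    -- the average capacity approaches the mixture
    Tendsto (fun N : ℕ => capacityUp p P g N -
      (weight p N * asympUnbounded p N + (1 - weight p N) * asympSaturated p N)) atTop (𝓝 0) ∧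
    -- and so does each regime separately
    Tendsto (fun N : ℕ => condCapacityUp p P g N (unboundedRegime p g N) - asympUnbounded p N)
      atTop (𝓝 0) ∧
    Tendsto (fun N : ℕ => condCapacityUp p P g N (unboundedRegime p g N)ᶜ - asympSaturated p N)
      atTop (𝓝 0) :=
  ⟨fun N => ⟨rateAgainst_zero p g N ▸ hg.integrable_rateAgainst hp le_rfl N,
    hg.integrable_rateAgainst hp hp.Pp_pos.le N, hg.integrable_departureRate hp N⟩,
    hg.tendsto_capacityUp_sub hp, hg.tendsto_condCapacityUp_unbounded_sub hp,
    hg.tendsto_condCapacityUp_saturated_sub hp⟩
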